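/- For $N\ge 1$ let $P_N$ be the joint law of the eigenvalues $z_1,\dots,z_N$ of the complex Ginibre ensemble (independent complex Gaussian entries of mean $0$ and variance $1/N$), that is, the probability measure on $\mathbb{C}^N$ $$dP_N(z_1,\dots,z_N)=\frac1{Z_N}\prod_{1\le l<k\le N}|z_l-z_k|^2\,\prod_{k=1}^N e^{-N|z_k|^2}\,d\Re(z_k)\,d\Im(z_k),$$ let $\#\mathcal I[a,b]$ be the number of indices $k$ with $|z_k|\in[a,b]$, and let $\mathrm{Var}_N$ denote the variance under $P_N$. For $c\ge 0$ put $$I_{mod}(c)=\sqrt{\pi}\int_{-\infty}^{\infty}\bigl(q_c(x)-q_c(x)^2\bigr)\,dx,\qquad q_c(x)=\int_x^{2c+x}e^{-t^2/2}\,\frac{dt}{\sqrt{2\pi}} .$$ (1) For fixed $0<a<b<1$, as $N\to\infty$, $$\mathrm{Var}_N\bigl(\#\mathcal I[a,b]\bigr)=\sqrt N\,\frac{a+b}{\sqrt\pi}+O(1).$$ (2) Let $a=a_N$ and $b=b_N$ be such that $a_N$ converges to a point of $(0,1)$ (for example, $a_N$ is a constant in $(0,1)$), $b_N-a_N\to0$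 and $N(b_N-a_N)\to\infty$. Then, as $N\to\infty$: (i) if $\sqrt N(b-a)\to\infty$, then $\mathrm{Var}_N(\#\mathcal I[a,b])=\sqrt N\,\frac{2a}{\sqrt\pi}\,(1+o(1))$; (ii) if $\sqrt N(b-a)\to c$ with $0<c<\infty$, then $\mathrm{Var}_N(\#\mathcal I[a,b])=\sqrt N\,\frac{a}{\sqrt\pi}\,I_{mod}\bigl(\sqrt N(b-a)\bigr)+O(1)$ and $\mathrm{Var}_N(\#\mathcal I[a,b])=\sqrt N\,\frac{a}{\sqrt\pi}\,I_{mod}(c)\,(1+o(1))$; if moreover $\sqrt N(b-a)=c+O(N^{-1/2})$, in particular if $b=a+c/\sqrt N$, then $\mathrm{Var}_N(\#\mathcal I[a,b])=\sqrt N\,\frac{a}{\sqrt\pi}\,I_{mod}(c)+O(1)$; (iii) if $\sqrt N(b-a)\to0$, then $\mathrm{Var}_N(\#\mathcal I[a,b])=N(b^2-a^2)(1+o(1))$. (3) The integral defining $I_{mod}(c)$ converges and $I_{mod}(c)\ge0$ for every $c\ge0$; moreover $\lim_{c\downarrow0}I_{mod}(c)=0$ and $\lim_{c\uparrow\infty}I_{mod}(c)=2$.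 -/

import Mathlib

open MeasureTheory ProbabilityTheory Filter Asymptotics Topology

noncomputable section

/-- The weight `μ_N(dz) = exp (-N |z|²) d(Re z) d(Im z)` on the complex plane. -/
def ginibreWeight (N : ℕ) : Measure ℂ :=
  (volume : Measure ℂ).withDensity fun z => ENNReal.ofReal (Real.exp (-(N : ℝ) * ‖z‖ ^ 2))

/-- The squared Vandermonde factor `∏_{l < k} |z_l - z_k|²`. -/
def vandermondeSq (N : ℕ) (z : Fin N → ℂ) : ℝ :=
  ∏ l : Fin N, ∏ k ∈ Finset.Ioi l, ‖z l - z k‖ ^ 2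

/-- The unnormalized joint law of the eigenvalues,
`∏_{l < k} |z_l - z_k|² μ_N(dz_1) ⋯ μ_N(dz_N)`. -/
def ginibreUnnormalized (N : ℕ) : Measure (Fin N → ℂ) :=
  (Measure.pi fun _ : Fin N => ginibreWeight N).withDensity
    fun z => ENNReal.ofReal (vandermondeSq N z)

/-- The joint law `P_N` of the eigenvalues of the complex Ginibre ensemble (entries of
variance `1 / N`): the unnormalized law divided by its total mass `Z_N`. -/
def ginibreLaw (N : ℕ) : Measure (Fin N → ℂ) :=
  (ginibreUnnormalized N Set.univ)⁻¹ • ginibreUnnormalized N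

/-- The linear statistic `X(f) = ∑_k f(z_k)`. -/
def linearStatistic (N : ℕ) (f : ℂ → ℝ) (z : Fin N → ℂ) : ℝ :=
  ∑ k, f (z k)

/-- The number of the points `z_1, …, z_N` (with multiplicity) with modulus in `[a, b]`. -/
def modulusCount (N : ℕ) (a b : ℝ) : (Fin N → ℂ) → ℝ :=
  linearStatistic N (Set.indicator {w : ℂ | ‖w‖ ∈ Set.Icc a b} fun _ => 1)

/-- The variance under `P_N` of the number of eigenvalues with modulus in `[a, b]`. -/
def modulusVar (N : ℕ) (a b : ℝ) : ℝ :=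
  variance (modulusCount N a b) (ginibreLaw N)

/-- The standard Gaussian mass of the window `[x, 2c + x]`, for `c ≥ 0`. -/
def gaussWindow (c x : ℝ) : ℝ :=
  ∫ t in x..(2 * c + x), Real.exp (-t ^ 2 / 2) / √(2 * Real.pi)

/-- `I_mod(c) = √π ∫ (q_c(x) - q_c(x)²) dx`, with `q_c(x)` the standard Gaussian mass of
`[x, 2c + x]`. -/
def Imod (c : ℝ) : ℝ :=
  √Real.pi * ∫ x : ℝ, (gaussWindow c x - gaussWindow c x ^ 2)

end

/-! Expand the squared Vandermonde factor into two determinants. Monomials of different degrees are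
orthogonal for a rotation-invariant weight, so for radial test functions only the diagonal terms
survive. The moduli are therefore a uniformly shuffled family of independent variables `R_k`, `k <
N`, with `N R_k²` Gamma distributed of shape `k + 1`. The count does not see the shuffling, so it
behaves as a sum of independent Bernoulli variables of parameters `p_k = F_k(N a²) - F_k(N b²)`,
where `F_k(x)` is the probability that a Poisson variable of mean `x` is at most `k`. The variance
is `∑ p_k (1 - p_k)` (`modulusVar_eq_sum`).

The `p_k` are not approximated one at a time; the sum is evaluated as a whole. For independent
integer variables `∑_k P(U ≤ k) P(V > k) = E (V - U)⁺`. With `x = N a²`, `y = N b²` and independent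
Poisson variables `X, X'` of mean `x` and `Y, Y'` of mean `y`, the sum over all `k` equals `E|X -
X'|/2 + E|Y - Y'|/2 - E|Y - X| + y - x`. The terms `k ≥ N` contribute `O(1)` because `b < 1`
(`abs_sum_poissonCdf_sub_le`). The first absolute moment is an integral of `(1 - Re φ(t)) / t²`, `φ`
being the characteristic function. Comparing characteristic functions shows that replacing a Poisson
difference by the Gaussian of the same mean and variance costs `O(1)`, whatever the means
(`abs_poissonAbsDiff_sub_gaussian_le`). What remains is the explicit `varMain`, written with
`gaussMin T = E min(T, |Z|)`.

Fubini gives `Imod c = √π √2 gaussMin (√2 c)` (`Imod_eq`). All regimes then follow from three facts: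
`gaussMin` is 1-Lipschitz, it is within `1 / (4T)` of its limit `E|Z|`, and it is within `T²` of
`T`. -/

/-! ### The rotation-invariant weight and orthogonality of monomials. -/

theorem integral_ginibreWeight {E : Type*} [NormedAddCommGroup E] [NormedSpace ℝ E] (N : ℕ)
    (g : ℂ → E) :
    ∫ z, g z ∂ginibreWeight N = ∫ z, Real.exp (-(N : ℝ) * ‖z‖ ^ 2) • g z := by
  rw [ginibreWeight, integral_withDensity_eq_integral_toReal_smul (by fun_prop) (by simp)]
  simp [ENNReal.toReal_ofReal (Real.exp_nonneg _)]

theorem integrable_ginibreWeight_iff {E : Type*} [NormedAddCommGroup E] [NormedSpace ℝ E] (N : ℕ)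
    (g : ℂ → E) :
    Integrable g (ginibreWeight N) ↔
      Integrable (fun z => Real.exp (-(N : ℝ) * ‖z‖ ^ 2) • g z) := by
  rw [ginibreWeight, integrable_withDensity_iff_integrable_smul' (by fun_prop) (by simp)]
  simp [ENNReal.toReal_ofReal (Real.exp_nonneg _)]

theorem integrable_norm_pow_ginibreWeight {N : ℕ} (hN : 0 < N) (m : ℕ) :
    Integrable (fun z : ℂ => ‖z‖ ^ m) (ginibreWeight N) := by
  rw [integrable_ginibreWeight_iff]
  have h := integrable_fun_norm_addHaar (volume : Measure ℂ)
    (f := fun y : ℝ => Real.exp (-(N : ℝ) * y ^ 2) • y ^ m)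
  rw [h]
  have h2 := integrableOn_rpow_mul_exp_neg_mul_sq (b := (N : ℝ)) (by exact_mod_cast hN)
    (s := (m + 1 : ℕ)) (by push_cast; linarith [(Nat.cast_nonneg m : (0:ℝ) ≤ m)])
  refine h2.congr_fun (fun y hy => ?_) measurableSet_Ioi
  simp only [Complex.finrank_real_complex, smul_eq_mul, Real.rpow_natCast]
  ring

instance sigmaFinite_ginibreWeight (N : ℕ) : SigmaFinite (ginibreWeight N) := by
  unfold ginibreWeight; infer_instance

/-- The weight is invariant under rotations. -/
theorem integral_ginibreWeight_rotation (N : ℕ) (u : Circle) (g : ℂ → ℂ) :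
    ∫ z, g (u * z) ∂ginibreWeight N = ∫ z, g z ∂ginibreWeight N := by
  rw [integral_ginibreWeight, integral_ginibreWeight]
  have h := (rotation u).measurePreserving.integral_comp
    (rotation u).toHomeomorph.measurableEmbedding
    (fun z => Real.exp (-(N : ℝ) * ‖z‖ ^ 2) • g z)
  simpa only [rotation_apply, norm_mul, Circle.norm_coe, one_mul] using h

/-- The point `exp(i)` works: `exp(i(m - n)) = 1` with `m ≠ n` would make `π` rational. -/
theorem exists_circle_pow_mul_conj_ne_one {m n : ℕ} (h : m ≠ n) :
    ∃ u : Circle, (u : ℂ) ^ m * (starRingEnd ℂ (u : ℂ)) ^ n ≠ 1 := by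
  refine ⟨Circle.exp 1, fun h1 => h ?_⟩
  have h2 : Complex.exp ((m : ℂ) * Complex.I - n * Complex.I) = 1 := by
    rw [← h1, Circle.coe_exp, ← Complex.exp_conj, ← Complex.exp_nat_mul, ← Complex.exp_nat_mul,
      ← Complex.exp_add]
    congr 1
    simp
    ring
  rw [Complex.exp_eq_one_iff] at h2
  obtain ⟨k, hk⟩ := h2
  have h3 : ((m : ℝ) - n) = k * (2 * Real.pi) := by
    have := congrArg Complex.im hk
    simpa using this
  by_contra hmn
  have hk0 : k ≠ 0 := by
    rintro rfl
    simp at h3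
    exact hmn (by exact_mod_cast sub_eq_zero.mp h3)
  apply irrational_pi
  refine ⟨((m : ℚ) - n) / (2 * k), ?_⟩
  push_cast
  rw [h3]
  have : (k : ℝ) ≠ 0 := by exact_mod_cast hk0
  field_simp

/-- The radial moment `∫ |z|^{2k} h(|z|) e^{-N|z|²} dz`. -/
noncomputable def radialMoment (N k : ℕ) (h : ℝ → ℝ) : ℝ :=
  ∫ z, ‖z‖ ^ (2 * k) * h ‖z‖ ∂ginibreWeight N

/-- A rotation by `u` multiplies the integrand by `u^m ū^n` and preserves the integral, which must
vanish once this factor differs from 1. -/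
theorem integral_pow_mul_conj_pow (N m n : ℕ) (h : ℝ → ℝ) :
    ∫ z : ℂ, z ^ m * (starRingEnd ℂ z) ^ n * (h ‖z‖ : ℂ) ∂ginibreWeight N =
      if m = n then (radialMoment N m h : ℂ) else 0 := by
  split_ifs with hmn
  · subst hmn
    rw [radialMoment, ← integral_complex_ofReal]
    congr 1 with z
    rw [← mul_pow, Complex.mul_conj, Complex.normSq_eq_norm_sq]
    push_cast
    ring
  · obtain ⟨u, hu⟩ := exists_circle_pow_mul_conj_ne_one hmn
    have h1 := integral_ginibreWeight_rotation N u
      (fun z : ℂ => z ^ m * (starRingEnd ℂ z) ^ n * (h ‖z‖ : ℂ))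
    have h2 : (fun z : ℂ => ((u : ℂ) * z) ^ m * (starRingEnd ℂ (u * z)) ^ n * (h ‖u * z‖ : ℂ)) =
        fun z => ((u : ℂ) ^ m * (starRingEnd ℂ (u : ℂ)) ^ n) *
          (z ^ m * (starRingEnd ℂ z) ^ n * (h ‖z‖ : ℂ)) := by
      ext z
      simp only [map_mul, norm_mul, Circle.norm_coe, one_mul]
      ring
    simp only [h2, integral_const_mul] at h1
    by_contra h3
    exact hu (mul_right_cancel₀ h3 (by rw [h1, one_mul]))

theorem integrable_pow_mul_conj_pow {N : ℕ} (hN : 0 < N) (m n : ℕ) {h : ℝ → ℝ}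
    (hm : Measurable h) (hb : ∀ y, |h y| ≤ 1) :
    Integrable (fun z : ℂ => z ^ m * (starRingEnd ℂ z) ^ n * (h ‖z‖ : ℂ)) (ginibreWeight N) := by
  refine (integrable_norm_pow_ginibreWeight hN (m + n)).mono' ?_ (ae_of_all _ fun z => ?_)
  · have : Measurable fun z : ℂ => (starRingEnd ℂ z) := Complex.continuous_conj.measurable
    exact Measurable.aestronglyMeasurable (by fun_prop)
  · simp only [norm_mul, norm_pow, RCLike.norm_conj, Complex.norm_real, Real.norm_eq_abs]
    rw [← pow_add]
    exact mul_le_of_le_one_right (by positivity) (hb _)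

/-! ### Expansion of the squared Vandermonde factor. -/

theorem vandermondeSq_eq_det (N : ℕ) (z : Fin N → ℂ) :
    ((vandermondeSq N z : ℝ) : ℂ) =
      (Matrix.vandermonde z).det * starRingEnd ℂ (Matrix.vandermonde z).det := by
  rw [Complex.mul_conj, Complex.normSq_eq_norm_sq, Matrix.det_vandermonde, vandermondeSq]
  simp only [norm_prod, ← Finset.prod_pow]
  push_cast
  refine Finset.prod_congr rfl fun i _ => Finset.prod_congr rfl fun j _ => ?_
  rw [norm_sub_rev]

/-- Expanding both determinants over permutations makes every term a product of functions of one
coordinate, so that Fubini applies. -/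
theorem vandermondeSq_mul_prod_eq_sum (N : ℕ) (h : Fin N → ℝ → ℝ) (z : Fin N → ℂ) :
    ((vandermondeSq N z * ∏ i, h i ‖z i‖ : ℝ) : ℂ) =
      ∑ s : Equiv.Perm (Fin N), ∑ t : Equiv.Perm (Fin N),
        ((Equiv.Perm.sign s : ℤ) : ℂ) * ((Equiv.Perm.sign t : ℤ) : ℂ) *
          ∏ i, (z i ^ (s i : ℕ) * (starRingEnd ℂ (z i)) ^ (t i : ℕ) * (h i ‖z i‖ : ℂ)) := by
  rw [Complex.ofReal_mul, vandermondeSq_eq_det, ← Matrix.det_transpose, Matrix.det_apply',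
    map_sum, Finset.sum_mul_sum, Finset.sum_mul]
  refine Finset.sum_congr rfl fun s _ => ?_
  rw [Finset.sum_mul]
  refine Finset.sum_congr rfl fun t _ => ?_
  simp only [Matrix.transpose_apply, Matrix.vandermonde_apply, map_mul, map_prod, map_pow,
    map_intCast, Complex.ofReal_prod, Finset.prod_mul_distrib]
  ring

theorem integrable_vandermondeSq_mul_prod {N : ℕ} (hN : 0 < N) {h : Fin N → ℝ → ℝ}
    (hm : ∀ i, Measurable (h i)) (hb : ∀ i y, |h i y| ≤ 1) :
    Integrable (fun z : Fin N → ℂ => vandermondeSq N z * ∏ i, h i ‖z i‖)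
      (Measure.pi fun _ => ginibreWeight N) := by
  suffices H : Integrable (fun z : Fin N → ℂ => ((vandermondeSq N z * ∏ i, h i ‖z i‖ : ℝ) : ℂ))
      (Measure.pi fun _ => ginibreWeight N) by
    simpa only [RCLike.re_eq_complex_re, Complex.ofReal_re] using H.re
  simp_rw [vandermondeSq_mul_prod_eq_sum]
  refine integrable_finsetSum _ fun s _ => integrable_finsetSum _ fun t _ => ?_
  refine Integrable.const_mul ?_ _
  exact Integrable.fintype_prod (f := fun i w => w ^ (s i : ℕ) * (starRingEnd ℂ w) ^ (t i : ℕ) *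
    (h i ‖w‖ : ℂ)) fun i => integrable_pow_mul_conj_pow hN _ _ (hm i) (hb i)

/-- Under the unnormalized law the moduli are a uniformly shuffled family of independent radial
variables. -/
theorem integral_vandermondeSq_mul_prod {N : ℕ} (hN : 0 < N) {h : Fin N → ℝ → ℝ}
    (hm : ∀ i, Measurable (h i)) (hb : ∀ i y, |h i y| ≤ 1) :
    ∫ z : Fin N → ℂ, vandermondeSq N z * ∏ i, h i ‖z i‖ ∂(Measure.pi fun _ => ginibreWeight N) =
      ∑ s : Equiv.Perm (Fin N), ∏ i, radialMoment N (s i) (h i) := by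
  have key : ∀ s t : Equiv.Perm (Fin N), Integrable (fun z : Fin N → ℂ =>
      ((Equiv.Perm.sign s : ℤ) : ℂ) * ((Equiv.Perm.sign t : ℤ) : ℂ) *
          ∏ i, (z i ^ (s i : ℕ) * (starRingEnd ℂ (z i)) ^ (t i : ℕ) * (h i ‖z i‖ : ℂ)))
      (Measure.pi fun _ => ginibreWeight N) := fun s t =>
    (Integrable.fintype_prod (f := fun i w => w ^ (s i : ℕ) * (starRingEnd ℂ w) ^ (t i : ℕ) *
      (h i ‖w‖ : ℂ)) fun i => integrable_pow_mul_conj_pow hN _ _ (hm i) (hb i)).const_mul _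
  apply Complex.ofReal_injective
  rw [← integral_complex_ofReal]
  simp_rw [vandermondeSq_mul_prod_eq_sum]
  rw [integral_finsetSum _ fun s _ => integrable_finsetSum _ fun t _ => key s t]
  push_cast
  refine Finset.sum_congr rfl fun s _ => ?_
  -- If `t ≠ s`, some coordinate carries unequal powers of `z` and its conjugate and integrates to
  -- zero; for `t = s` the signs cancel.
  rw [integral_finsetSum _ fun t _ => key s t, Finset.sum_eq_single s]
  · rw [integral_const_mul, integral_fintype_prod_eq_prod
      (f := fun i w => w ^ (s i : ℕ) * (starRingEnd ℂ w) ^ (s i : ℕ) * (h i ‖w‖ : ℂ))]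
    simp only [integral_pow_mul_conj_pow, if_true]
    rw [← Int.cast_mul, ← Units.val_mul, Int.units_mul_self]
    simp
  · intro t _ hts
    rw [integral_const_mul, integral_fintype_prod_eq_prod
      (f := fun i w => w ^ (s i : ℕ) * (starRingEnd ℂ w) ^ (t i : ℕ) * (h i ‖w‖ : ℂ))]
    simp only [integral_pow_mul_conj_pow]
    obtain ⟨i, hi⟩ : ∃ i, s i ≠ t i := by
      by_contra! hc
      exact hts (Equiv.ext fun i => (hc i).symm)
    rw [Finset.prod_eq_zero (Finset.mem_univ i), mul_zero]
    rw [if_neg]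
    exact fun hc => hi (Fin.ext hc)
  · simp

/-! ### Radial moments and Gamma–Poisson duality. -/

/-- The Poisson distribution function `e^{-x} ∑_{i ≤ k} x^i / i!`. -/
noncomputable def poissonCdf (k : ℕ) (x : ℝ) : ℝ :=
  Real.exp (-x) * ∑ i ∈ Finset.range (k + 1), x ^ i / (i.factorial : ℝ)

theorem hasDerivAt_poissonCdf (k : ℕ) (x : ℝ) :
    HasDerivAt (poissonCdf k) (-(Real.exp (-x) * (x ^ k / (k.factorial : ℝ)))) x := by
  induction k with
  | zero =>
    have h := (hasDerivAt_neg x).exp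
    have h2 : poissonCdf 0 = fun y => Real.exp (-y) := by
      ext y; simp [poissonCdf]
    rw [h2]
    simpa using h
  | succ k ih =>
    have h2 : poissonCdf (k + 1) = fun y =>
        poissonCdf k y + Real.exp (-y) * (y ^ (k + 1) / ((k + 1).factorial : ℝ)) := by
      ext y
      simp only [poissonCdf]
      rw [Finset.sum_range_succ _ (k + 1)]
      ring
    rw [h2]
    have h3 := ih.add (((hasDerivAt_neg x).exp).mul
      ((hasDerivAt_pow (k + 1) x).div_const ((k + 1).factorial : ℝ)))
    refine h3.congr_deriv ?_
    rw [Nat.factorial_succ]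
    have : (k.factorial : ℝ) ≠ 0 := by positivity
    have : ((k : ℝ) + 1) ≠ 0 := by positivity
    push_cast
    field_simp
    ring

theorem tendsto_poissonCdf (k : ℕ) : Tendsto (poissonCdf k) atTop (𝓝 0) := by
  have h : poissonCdf k = fun x => ∑ i ∈ Finset.range (k + 1),
      (x ^ i * Real.exp (-x)) / (i.factorial : ℝ) := by
    ext x
    rw [poissonCdf, Finset.mul_sum]
    exact Finset.sum_congr rfl fun i _ => by ring
  rw [h, ← Finset.sum_const_zero (s := Finset.range (k + 1))]
  refine tendsto_finsetSum _ fun i _ => ?_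
  simpa using (Real.tendsto_pow_mul_exp_neg_atTop_nhds_zero i).div_const (i.factorial : ℝ)

theorem poissonCdf_zero (k : ℕ) : poissonCdf k 0 = 1 := by
  simp [poissonCdf, Finset.sum_range_succ']

theorem radialMoment_eq (N k : ℕ) (h : ℝ → ℝ) :
    radialMoment N k h =
      2 * Real.pi * ∫ y in Set.Ioi (0 : ℝ), y ^ (2 * k + 1) * Real.exp (-(N : ℝ) * y ^ 2) * h y := by
  rw [radialMoment, integral_ginibreWeight]
  have := integral_fun_norm_addHaar (volume : Measure ℂ)
    (fun y => Real.exp (-(N : ℝ) * y ^ 2) • (y ^ (2 * k) * h y))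
  rw [this, Complex.finrank_real_complex, measureReal_def, Complex.volume_ball]
  simp only [nsmul_eq_mul, smul_eq_mul]
  rw [show ((2 : ℕ) : ℝ) = 2 by norm_num]
  simp only [ENNReal.ofReal_one, one_pow, one_mul, ENNReal.coe_toReal, NNReal.coe_real_pi, mul_assoc]
  congr 3
  ext y
  ring_nf

/-- The derivative of the Poisson distribution function in its mean telescopes to a single term,
which is, up to the change of variable `N y²`, the radial density of the `k`-th modulus. -/
theorem hasDerivAt_poissonCdf_mul_sq {N : ℕ} (hN : 0 < N) (k : ℕ) (y : ℝ) :
    HasDerivAt (fun y => -((k.factorial : ℝ) / (2 * (N : ℝ) ^ (k + 1))) * poissonCdf k (N * y ^ 2))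
      (y ^ (2 * k + 1) * Real.exp (-(N : ℝ) * y ^ 2)) y := by
  have h1 : HasDerivAt (fun y : ℝ => (N : ℝ) * y ^ 2) (N * (2 * y)) y := by
    simpa using (hasDerivAt_pow 2 y).const_mul (N : ℝ)
  refine (((hasDerivAt_poissonCdf k (N * y ^ 2)).comp y h1).const_mul _).congr_deriv ?_
  have : (k.factorial : ℝ) ≠ 0 := by positivity
  have : (N : ℝ) ≠ 0 := by positivity
  field_simp
  ring

theorem radialMoment_one {N : ℕ} (hN : 0 < N) (k : ℕ) :
    radialMoment N k (fun _ => 1) = Real.pi * k.factorial / (N : ℝ) ^ (k + 1) := by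
  rw [radialMoment_eq]
  simp only [mul_one]
  have hN' : (0 : ℝ) < N := by exact_mod_cast hN
  rw [integral_Ioi_of_hasDerivAt_of_nonneg' (fun y _ => hasDerivAt_poissonCdf_mul_sq hN k y)
    (l := 0)]
  · simp [poissonCdf_zero]
    field_simp
  · intro y hy
    have : (0 : ℝ) < y := hy
    positivity
  · have h2 : Tendsto (fun y : ℝ => (N : ℝ) * y ^ 2) atTop atTop :=
      (tendsto_pow_atTop two_ne_zero).const_mul_atTop hN'
    simpa using ((tendsto_poissonCdf k).comp h2).const_mul
      (-((k.factorial : ℝ) / (2 * (N : ℝ) ^ (k + 1))))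

/-- Gamma–Poisson duality: a Gamma variable of shape `k + 1` exceeds `x` with the probability that a
Poisson variable of mean `x` is at most `k`. -/
theorem radialMoment_indicator {N : ℕ} (hN : 0 < N) (k : ℕ) {a b : ℝ} (ha : 0 ≤ a) (hab : a ≤ b) :
    radialMoment N k ((Set.Icc a b).indicator fun _ => 1) =
      radialMoment N k (fun _ => 1) * (poissonCdf k (N * a ^ 2) - poissonCdf k (N * b ^ 2)) := by
  have hN' : (0 : ℝ) < N := by exact_mod_cast hN
  rw [radialMoment_one hN, radialMoment_eq]
  have h1 : ∀ y : ℝ, y ^ (2 * k + 1) * Real.exp (-(N : ℝ) * y ^ 2) *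
      (Set.Icc a b).indicator (fun _ => (1 : ℝ)) y =
      (Set.Icc a b).indicator (fun y => y ^ (2 * k + 1) * Real.exp (-(N : ℝ) * y ^ 2)) y := by
    intro y
    by_cases hy : y ∈ Set.Icc a b <;> simp [hy]
  simp_rw [h1]
  rw [← integral_Ici_eq_integral_Ioi, setIntegral_indicator measurableSet_Icc,
    (Set.inter_eq_right.mpr fun y hy => ha.trans hy.1 : Set.Ici 0 ∩ Set.Icc a b = Set.Icc a b), integral_Icc_eq_integral_Ioc,
    ← intervalIntegral.integral_of_le hab,
    intervalIntegral.integral_eq_sub_of_hasDerivAt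
      (fun y _ => hasDerivAt_poissonCdf_mul_sq hN k y)
      (Continuous.intervalIntegrable (by fun_prop) _ _)]
  field_simp
  ring

/-! ### Kostlan's theorem and the variance as a sum of Bernoulli variances. -/

theorem vandermondeSq_nonneg (N : ℕ) (z : Fin N → ℂ) : 0 ≤ vandermondeSq N z :=
  Finset.prod_nonneg fun _ _ => Finset.prod_nonneg fun _ _ => by positivity

theorem measurable_vandermondeSq (N : ℕ) : Measurable (vandermondeSq N) := by
  unfold vandermondeSq
  fun_prop

theorem integral_ginibreUnnormalized (N : ℕ) (g : (Fin N → ℂ) → ℝ) :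
    ∫ z, g z ∂ginibreUnnormalized N =
      ∫ z, vandermondeSq N z * g z ∂(Measure.pi fun _ => ginibreWeight N) := by
  rw [ginibreUnnormalized, integral_withDensity_eq_integral_toReal_smul
    (measurable_vandermondeSq N).ennreal_ofReal (by simp)]
  simp [ENNReal.toReal_ofReal (vandermondeSq_nonneg _ _)]

theorem ginibreUnnormalized_univ {N : ℕ} (hN : 0 < N) :
    ginibreUnnormalized N Set.univ =
      ENNReal.ofReal (N.factorial * ∏ i : Fin N, radialMoment N i (fun _ => 1)) := by
  rw [ginibreUnnormalized, withDensity_apply _ MeasurableSet.univ, Measure.restrict_univ,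
    ← ofReal_integral_eq_lintegral_ofReal]
  · have h := integral_vandermondeSq_mul_prod hN (h := fun _ _ => 1) (fun _ => measurable_const)
      (by simp)
    simp only [Finset.prod_const_one, mul_one] at h
    rw [h]
    congr 1
    rw [Finset.sum_congr rfl fun s _ => Equiv.prod_comp s
      fun i : Fin N => radialMoment N i (fun _ => 1)]
    simp [Fintype.card_perm]
  · simpa using integrable_vandermondeSq_mul_prod hN (h := fun _ _ => 1)
      (fun _ => measurable_const) (by simp)
  · exact ae_of_all _ (vandermondeSq_nonneg N)

theorem radialMoment_one_pos {N : ℕ} (hN : 0 < N) (k : ℕ) : 0 < radialMoment N k (fun _ => 1) := by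
  rw [radialMoment_one hN]
  have : (0 : ℝ) < N := by exact_mod_cast hN
  positivity

theorem isProbabilityMeasure_ginibreLaw {N : ℕ} (hN : 0 < N) :
    IsProbabilityMeasure (ginibreLaw N) := by
  refine ⟨?_⟩
  rw [ginibreLaw, Measure.smul_apply, smul_eq_mul, ENNReal.inv_mul_cancel]
  · rw [ginibreUnnormalized_univ hN]
    have := Finset.prod_pos (s := Finset.univ) fun (i : Fin N) _ => radialMoment_one_pos hN i
    simp only [ne_eq, ENNReal.ofReal_eq_zero, not_le]
    positivity
  · rw [ginibreUnnormalized_univ hN]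
    exact ENNReal.ofReal_ne_top

/-- Kostlan's theorem: under `P_N` the moduli are a uniformly shuffled family of independent
variables. -/
theorem integral_prod_ginibreLaw {N : ℕ} (hN : 0 < N) {h : Fin N → ℝ → ℝ}
    (hm : ∀ i, Measurable (h i)) (hb : ∀ i y, |h i y| ≤ 1) :
    ∫ z, ∏ i, h i ‖z i‖ ∂ginibreLaw N =
      (N.factorial : ℝ)⁻¹ * ∑ s : Equiv.Perm (Fin N),
        ∏ i, (radialMoment N (s i) (h i) / radialMoment N (s i) (fun _ => 1)) := by
  have hpos := Finset.prod_pos (s := Finset.univ) fun (i : Fin N) _ => radialMoment_one_pos hN i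
  rw [ginibreLaw, integral_smul_measure, integral_ginibreUnnormalized,
    integral_vandermondeSq_mul_prod hN hm hb, ginibreUnnormalized_univ hN, ENNReal.toReal_inv,
    ENNReal.toReal_ofReal (by positivity), smul_eq_mul, mul_inv, mul_assoc, Finset.mul_sum]
  congr 1
  refine Finset.sum_congr rfl fun s _ => ?_
  rw [Finset.prod_div_distrib,
    Equiv.prod_comp s fun i : Fin N => radialMoment N i (fun _ => 1)]
  field_simp

/-- The probability that the `k`-th independent modulus lies in `[a, b]`. -/
noncomputable def annulusProb (N : ℕ) (a b : ℝ) (k : ℕ) : ℝ :=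
  poissonCdf k (N * a ^ 2) - poissonCdf k (N * b ^ 2)

theorem sum_perm_const_mul {N : ℕ} (c : ℝ) :
    (N.factorial : ℝ)⁻¹ * ∑ _s : Equiv.Perm (Fin N), c = c := by
  have : (N.factorial : ℝ) ≠ 0 := by positivity
  simp [Fintype.card_perm]
  field_simp

theorem integral_prod_indicator_ginibreLaw {N : ℕ} (hN : 0 < N) {a b : ℝ} (ha : 0 ≤ a)
    (hab : a ≤ b) (S : Finset (Fin N)) :
    ∫ z, ∏ i ∈ S, (Set.Icc a b).indicator (fun _ => (1 : ℝ)) ‖z i‖ ∂ginibreLaw N =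
      (N.factorial : ℝ)⁻¹ * ∑ s : Equiv.Perm (Fin N), ∏ i ∈ S, annulusProb N a b (s i) := by
  classical
  have h := integral_prod_ginibreLaw hN
    -- The constant 1 outside `S` integrates those coordinates out.
    (h := fun i => if i ∈ S then (Set.Icc a b).indicator (fun _ => (1 : ℝ)) else fun _ => 1)
    (fun i => by
      split_ifs
      · exact measurable_const.indicator measurableSet_Icc
      · exact measurable_const)
    (fun i y => by
      split_ifs
      · by_cases hy : y ∈ Set.Icc a b <;> simp [hy]
      · simp)
  have e1 : ∀ z : Fin N → ℂ, ∏ i, (if i ∈ S then (Set.Icc a b).indicator (fun _ => (1 : ℝ))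
      else fun _ => 1) ‖z i‖ = ∏ i ∈ S, (Set.Icc a b).indicator (fun _ => (1 : ℝ)) ‖z i‖ := by
    intro z
    rw [← Finset.prod_filter_mul_prod_filter_not Finset.univ (· ∈ S)]
    rw [Finset.prod_congr rfl (g := fun i => (Set.Icc a b).indicator (fun _ => (1 : ℝ)) ‖z i‖)
      (fun i hi => by simp [(Finset.mem_filter.mp hi).2])]
    rw [Finset.prod_congr rfl (g := fun i => 1) (s₁ := Finset.univ.filter (¬ · ∈ S))
      (fun i hi => by simp [(Finset.mem_filter.mp hi).2])]
    simp
  simp_rw [e1] at h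
  rw [h]
  congr 1
  refine Finset.sum_congr rfl fun s _ => ?_
  rw [← Finset.prod_subset (Finset.subset_univ S)]
  · refine Finset.prod_congr rfl fun i hi => ?_
    rw [if_pos hi, radialMoment_indicator hN _ ha hab, annulusProb,
      mul_div_cancel_left₀ _ (radialMoment_one_pos hN _).ne']
  · intro i _ hi
    rw [if_neg hi, div_self (radialMoment_one_pos hN _).ne']

theorem modulusCount_eq (N : ℕ) (a b : ℝ) (z : Fin N → ℂ) :
    modulusCount N a b z = ∑ k, (Set.Icc a b).indicator (fun _ => (1 : ℝ)) ‖z k‖ := by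
  simp [modulusCount, linearStatistic, Set.indicator]

/-- Only one- and two-point expectations enter. Their sums over all indices are invariant under
relabelling by a permutation, so the average over shufflings disappears and independence of the
factors gives a sum of Bernoulli variances. -/
theorem modulusVar_eq_sum {N : ℕ} (hN : 0 < N) {a b : ℝ} (ha : 0 ≤ a) (hab : a ≤ b) :
    modulusVar N a b =
      ∑ k ∈ Finset.range N, annulusProb N a b k * (1 - annulusProb N a b k) := by
  classical
  have := isProbabilityMeasure_ginibreLaw hN
  set χ : ℝ → ℝ := (Set.Icc a b).indicator fun _ => (1 : ℝ) with hχ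
  have hχm : Measurable χ := measurable_const.indicator measurableSet_Icc
  have hχb : ∀ y, |χ y| ≤ 1 := fun y => by
    by_cases hy : y ∈ Set.Icc a b <;> simp [hχ, hy]
  have hχi : ∀ y, χ y * χ y = χ y := fun y => by
    by_cases hy : y ∈ Set.Icc a b <;> simp [hχ, hy]
  have hcount : modulusCount N a b = fun z => ∑ k, χ ‖z k‖ := funext (modulusCount_eq N a b)
  have hmeas : ∀ S : Finset (Fin N), Measurable fun z : Fin N → ℂ => ∏ i ∈ S, χ ‖z i‖ :=
    fun S => Finset.measurable_prod _ fun i _ => hχm.comp (measurable_pi_apply i).norm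
  have hint : ∀ S : Finset (Fin N), Integrable (fun z : Fin N → ℂ => ∏ i ∈ S, χ ‖z i‖)
      (ginibreLaw N) := fun S =>
    Integrable.of_bound (hmeas S).aestronglyMeasurable 1 (ae_of_all _ fun z => by
      rw [norm_prod]
      exact Finset.prod_le_one (fun _ _ => norm_nonneg _) fun i _ => hχb _)
  have hmem : MemLp (modulusCount N a b) 2 (ginibreLaw N) := by
    rw [hcount]
    refine memLp_finsetSum _ fun k _ => MemLp.of_bound
      (hχm.comp (measurable_pi_apply k).norm).aestronglyMeasurable 1 (ae_of_all _ fun z => hχb _)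
  have hE : ∀ S : Finset (Fin N), ∫ z, ∏ i ∈ S, χ ‖z i‖ ∂ginibreLaw N = _ :=
    integral_prod_indicator_ginibreLaw hN ha hab
  set p := annulusProb N a b with hp
  have hsum1 : ∀ s : Equiv.Perm (Fin N), ∀ g : ℝ → ℝ,
      ∑ k, g (p (s k)) = ∑ k ∈ Finset.range N, g (p k) := fun s g => by
    rw [Equiv.sum_comp s fun k : Fin N => g (p k), Finset.sum_range]
  have h1 : ∫ z, modulusCount N a b z ∂ginibreLaw N = ∑ k ∈ Finset.range N, p k := by
    rw [hcount, integral_finsetSum _ fun k _ => by simpa using hint {k}]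
    have : ∀ k : Fin N, ∫ z, χ ‖z k‖ ∂ginibreLaw N = (N.factorial : ℝ)⁻¹ *
        ∑ s : Equiv.Perm (Fin N), p (s k) := fun k => by simpa using hE {k}
    simp_rw [this]
    rw [← Finset.mul_sum, Finset.sum_comm]
    simp_rw [hsum1 _ fun x => x]
    exact sum_perm_const_mul _
  -- On the diagonal `{k, l}` collapses to one point; idempotence of the indicator lets one formula
  -- serve both cases.
  have hpair : ∀ (f : Fin N → ℝ) (k l : Fin N), (k = l → f k * f l = f k) →
      f k * f l = ∏ i ∈ ({k, l} : Finset (Fin N)), f i := by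
    intro f k l hf
    by_cases hkl : k = l
    · subst hkl
      simpa using hf rfl
    · rw [Finset.prod_pair hkl]
  have h2 : ∫ z, (modulusCount N a b ^ 2) z ∂ginibreLaw N =
      (∑ k ∈ Finset.range N, p k) ^ 2 - ∑ k ∈ Finset.range N, p k ^ 2 +
        ∑ k ∈ Finset.range N, p k := by
    have e : ∀ z, (modulusCount N a b ^ 2) z =
        ∑ k : Fin N, ∑ l : Fin N, ∏ i ∈ ({k, l} : Finset (Fin N)), χ ‖z i‖ := fun z => by
      rw [Pi.pow_apply, hcount, pow_two, Finset.sum_mul_sum]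
      refine Finset.sum_congr rfl fun k _ => Finset.sum_congr rfl fun l _ => ?_
      refine hpair (fun i => χ ‖z i‖) k l ?_
      rintro rfl
      exact hχi _
    simp_rw [e]
    rw [integral_finsetSum _ fun k _ => integrable_finsetSum _ fun l _ => hint _]
    simp_rw [integral_finsetSum _ fun l _ => hint _, hE]
    simp_rw [← Finset.mul_sum]
    rw [Finset.sum_congr rfl fun k _ => Finset.sum_comm, Finset.sum_comm]
    have e2 : ∀ s : Equiv.Perm (Fin N), ∑ k : Fin N, ∑ l : Fin N,
        ∏ i ∈ ({k, l} : Finset (Fin N)), p (s i) =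
        (∑ k ∈ Finset.range N, p k) ^ 2 - ∑ k ∈ Finset.range N, p k ^ 2 +
          ∑ k ∈ Finset.range N, p k := fun s => by
      -- The diagonal contributes `p` where a full product would give `p²`; the correction `p - p²`
      -- produces the variance.
      have e3 : ∀ k l : Fin N, ∏ i ∈ ({k, l} : Finset (Fin N)), p (s i) =
          p (s k) * p (s l) + if k = l then p (s k) - p (s k) ^ 2 else 0 := fun k l => by
        by_cases hkl : k = l
        · subst hkl
          simp
          ring
        · rw [Finset.prod_pair hkl, if_neg hkl, add_zero]
      simp_rw [e3, Finset.sum_add_distrib]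
      rw [← Finset.sum_mul_sum]
      simp only [Finset.sum_ite_eq, Finset.mem_univ, if_true, Finset.sum_sub_distrib]
      rw [hsum1 s fun x => x, hsum1 s fun x => x ^ 2]
      ring
    simp_rw [e2]
    exact sum_perm_const_mul _
  rw [modulusVar, variance_eq_sub hmem, h1, h2]
  simp_rw [mul_sub, Finset.sum_sub_distrib, mul_one, ← pow_two]
  ring

/-! ### Sums of distribution functions as mean absolute differences of Poisson variables. -/

/-- Exactly `(v - u)⁺` integers `k` satisfy `u ≤ k < v`. -/
theorem tsum_indicator_Iic_prod_Ioi (u v : ℕ) :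
    ∑' k : ℕ, (Set.Iic k ×ˢ Set.Ioi k : Set (ℕ × ℕ)).indicator (fun _ => (1 : ENNReal)) (u, v) =
      ENNReal.ofReal (max ((v : ℝ) - u) 0) := by
  have h : ∀ k : ℕ, (Set.Iic k ×ˢ Set.Ioi k : Set (ℕ × ℕ)).indicator (fun _ => (1 : ENNReal))
      (u, v) = if k ∈ Finset.Ico u v then 1 else 0 := fun k => by
    simp [Set.indicator]
  simp_rw [h]
  rw [tsum_eq_sum (s := Finset.Ico u v) (fun k hk => by simp [hk])]
  simp only [Finset.sum_ite_mem, Finset.inter_self, Finset.sum_const, Nat.card_Ico, nsmul_eq_mul,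
    mul_one]
  rcases le_total u v with huv | huv
  · rw [max_eq_left (by simpa using huv), ← Nat.cast_sub huv, ENNReal.ofReal_natCast]
  · rw [max_eq_right (by simpa using huv), Nat.sub_eq_zero_of_le huv]
    simp

theorem integrable_max_sub (P Q : Measure ℕ) [IsProbabilityMeasure P] [IsProbabilityMeasure Q]
    (hQ : Integrable (fun n : ℕ => (n : ℝ)) Q) :
    Integrable (fun p : ℕ × ℕ => max ((p.2 : ℝ) - p.1) 0) (P.prod Q) := by
  refine (hQ.comp_snd P).mono' .of_discrete (ae_of_all _ fun p => ?_)
  rw [Real.norm_of_nonneg (le_max_right _ _)]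
  exact max_le (by simp) (by simp)

/-- `∑_k P(U ≤ k) P(V > k) = E (V - U)⁺` for independent `U`, `V`. -/
theorem hasSum_measureReal_Iic_mul_Ioi (P Q : Measure ℕ) [IsProbabilityMeasure P]
    [IsProbabilityMeasure Q] (hQ : Integrable (fun n : ℕ => (n : ℝ)) Q) :
    HasSum (fun k : ℕ => P.real (Set.Iic k) * Q.real (Set.Ioi k))
      (∫ p, max ((p.2 : ℝ) - p.1) 0 ∂(P.prod Q)) := by
  have h1 : ∑' k : ℕ, P (Set.Iic k) * Q (Set.Ioi k) =
      ∫⁻ p, ENNReal.ofReal (max ((p.2 : ℝ) - p.1) 0) ∂(P.prod Q) := by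
    simp_rw [← tsum_indicator_Iic_prod_Ioi]
    rw [lintegral_tsum fun k => .of_discrete]
    refine tsum_congr fun k => ?_
    rw [← Measure.prod_prod, lintegral_indicator (.of_discrete)]
    simp
  have hi := integrable_max_sub P Q hQ
  have h2 : ∑' k : ℕ, P (Set.Iic k) * Q (Set.Ioi k) ≠ ⊤ := by
    rw [h1]
    exact hi.lintegral_lt_top.ne
  have h0 : 0 ≤ᵐ[P.prod Q] fun p : ℕ × ℕ => max ((p.2 : ℝ) - p.1) 0 :=
    ae_of_all _ fun p => le_max_right _ _
  rw [integral_eq_lintegral_of_nonneg_ae h0 hi.aestronglyMeasurable, ← h1]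
  have h3 := ENNReal.hasSum_toReal h2
  rw [← ENNReal.tsum_toReal_eq fun k => ENNReal.ne_top_of_tsum_ne_top h2 k] at h3
  simpa [Measure.real, ENNReal.toReal_mul] using h3

/-- The first `k` terms vanish, and shifting the index by `k` cancels the falling factorial and
leaves `r^k` times the total Poisson mass. -/
theorem hasSum_descFactorial_poisson (r : NNReal) (k : ℕ) :
    HasSum (fun n : ℕ => Real.exp (-r) * r ^ n / n.factorial * (n.descFactorial k : ℝ))
      ((r : ℝ) ^ k) := by
  rw [← hasSum_nat_add_iff' k, Finset.sum_eq_zero, sub_zero]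
  · have h := (hasSum_one_poissonMeasure r).mul_left ((r : ℝ) ^ k)
    rw [mul_one] at h
    refine h.congr_fun fun n => ?_
    have h1 : ((n + k).factorial : ℝ) = n.factorial * ((n + k).descFactorial k : ℝ) := by
      have := Nat.factorial_mul_descFactorial (Nat.le_add_left k n)
      rw [Nat.add_sub_cancel] at this
      exact_mod_cast this.symm
    have h2 : (n.factorial : ℝ) ≠ 0 := by positivity
    have h3 : ((n + k).descFactorial k : ℝ) ≠ 0 := by
      have : (n + k).descFactorial k ≠ 0 := by
        rw [Ne, Nat.descFactorial_eq_zero_iff_lt]; omega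
      exact_mod_cast this
    rw [h1]
    field_simp
    ring
  · intro i hi
    rw [Nat.descFactorial_eq_zero_iff_lt.mpr (Finset.mem_range.mp hi)]
    simp

theorem integrable_descFactorial_poisson (r : NNReal) (k : ℕ) :
    Integrable (fun n : ℕ => (n.descFactorial k : ℝ)) (poissonMeasure r) := by
  rw [integrable_poissonMeasure_iff]
  simpa using (hasSum_descFactorial_poisson r k).summable

theorem integral_descFactorial_poisson (r : NNReal) (k : ℕ) :
    ∫ n, (n.descFactorial k : ℝ) ∂poissonMeasure r = (r : ℝ) ^ k := by
  rw [integral_poissonMeasure]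
  simpa using (hasSum_descFactorial_poisson r k).tsum_eq

theorem integrable_cast_poisson (r : NNReal) :
    Integrable (fun n : ℕ => (n : ℝ)) (poissonMeasure r) := by
  simpa using integrable_descFactorial_poisson r 1

theorem integral_cast_poisson (r : NNReal) : ∫ n, (n : ℝ) ∂poissonMeasure r = r := by
  simpa using integral_descFactorial_poisson r 1

theorem sq_sub_eq_descFactorial (r : ℝ) (n : ℕ) :
    ((n : ℝ) - r) ^ 2 = (n.descFactorial 2 : ℝ) + (1 - 2 * r) * n + r ^ 2 := by
  have : (n.descFactorial 2 : ℝ) = n * (n - 1) := by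
    rcases n with _ | n
    · simp
    · simp [Nat.descFactorial_succ]
      ring
  rw [this]
  ring

theorem integrable_sq_sub_poisson (r : NNReal) :
    Integrable (fun n : ℕ => ((n : ℝ) - r) ^ 2) (poissonMeasure r) := by
  simp_rw [sq_sub_eq_descFactorial]
  exact ((integrable_descFactorial_poisson r 2).add ((integrable_cast_poisson r).const_mul _)).add
    (integrable_const _)

theorem integral_sq_sub_poisson (r : NNReal) :
    ∫ n, ((n : ℝ) - r) ^ 2 ∂poissonMeasure r = r := by
  simp_rw [sq_sub_eq_descFactorial]
  have h1 := integrable_descFactorial_poisson r 2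
  have h2 := (integrable_cast_poisson r).const_mul (1 - 2 * (r : ℝ))
  rw [integral_add (by exact h1.add h2) (integrable_const _), integral_add h1 h2,
    integral_const_mul, integral_descFactorial_poisson, integral_cast_poisson]
  simp
  ring

theorem poissonMeasure_real_Iic (r : NNReal) (k : ℕ) :
    (poissonMeasure r).real (Set.Iic k) = poissonCdf k r := by
  have h : (Set.Iic k : Set ℕ) = ↑(Finset.range (k + 1)) := by
    ext i; simp
  rw [h, ← sum_measureReal_singleton, poissonCdf, Finset.mul_sum]
  refine Finset.sum_congr rfl fun i _ => ?_
  rw [poissonMeasure_real_singleton]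
  ring

theorem poissonMeasure_real_Ioi (r : NNReal) (k : ℕ) :
    (poissonMeasure r).real (Set.Ioi k) = 1 - poissonCdf k r := by
  rw [← poissonMeasure_real_Iic, ← Set.compl_Iic, probReal_compl_eq_one_sub .of_discrete]

theorem poissonCdf_mem_Icc {r : ℝ} (hr : 0 ≤ r) (k : ℕ) : poissonCdf k r ∈ Set.Icc 0 1 := by
  lift r to NNReal using hr
  rw [← poissonMeasure_real_Iic]
  exact ⟨measureReal_nonneg, measureReal_le_one⟩

/-- `E |U - V|` for independent Poisson variables of means `r` and `s`. -/
noncomputable def poissonAbsDiff (r s : NNReal) : ℝ :=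
  ∫ p : ℕ × ℕ, |(p.1 : ℝ) - p.2| ∂((poissonMeasure r).prod (poissonMeasure s))

theorem integrable_sub_poisson (r s : NNReal) :
    Integrable (fun p : ℕ × ℕ => (p.1 : ℝ) - p.2) ((poissonMeasure r).prod (poissonMeasure s)) :=
  ((integrable_cast_poisson r).comp_fst _).sub ((integrable_cast_poisson s).comp_snd _)

/-- Take expectations in `(V - U)⁺ = (|U - V| - (U - V)) / 2`. -/
theorem hasSum_poissonCdf_mul (r s : NNReal) :
    HasSum (fun k : ℕ => poissonCdf k r * (1 - poissonCdf k s))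
      ((poissonAbsDiff r s + s - r) / 2) := by
  have h := hasSum_measureReal_Iic_mul_Ioi (poissonMeasure r) (poissonMeasure s)
    (integrable_cast_poisson s)
  simp_rw [poissonMeasure_real_Iic, poissonMeasure_real_Ioi] at h
  convert h using 1
  have e : ∀ p : ℕ × ℕ, max ((p.2 : ℝ) - p.1) 0 =
      (1 / 2) * (|(p.1 : ℝ) - p.2| - ((p.1 : ℝ) - p.2)) := fun p => by
    rcases le_total (p.1 : ℝ) p.2 with h | h
    · rw [max_eq_left (by linarith), abs_of_nonpos (by linarith)]; ring
    · rw [max_eq_right (by linarith), abs_of_nonneg (by linarith)]; ring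
  simp_rw [e]
  have hi := integrable_sub_poisson r s
  rw [integral_const_mul, integral_sub hi.abs hi,
    integral_sub ((integrable_cast_poisson r).comp_fst _) ((integrable_cast_poisson s).comp_snd _),
    integral_fun_fst, integral_fun_snd, integral_cast_poisson, integral_cast_poisson,
    poissonAbsDiff]
  simp
  ring

/-- The Poisson tail `∑_{k ≥ N} P(V > k) = E (V - N)⁺`. -/
theorem hasSum_poissonCdf_tail (s : NNReal) {N : ℕ} (hs : (s : ℝ) < N) :
    ∃ t ≤ (s : ℝ) / (4 * (N - s)),
      HasSum (fun k : ℕ => 1 - poissonCdf (k + N) s) t := by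
  -- With `U = N` deterministic, `P(U ≤ k)` is 0 below `N` and 1 from `N` on, which leaves exactly
  -- the tail.
  have h := hasSum_measureReal_Iic_mul_Ioi (Measure.dirac N) (poissonMeasure s)
    (integrable_cast_poisson s)
  have hd : 0 < (N : ℝ) - s := by linarith
  refine ⟨∫ p, max ((p.2 : ℝ) - p.1) 0 ∂((Measure.dirac N).prod (poissonMeasure s)), ?_, ?_⟩
  swap
  · rw [← hasSum_nat_add_iff' N, Finset.sum_eq_zero, sub_zero] at h
    · refine h.congr_fun fun k => ?_
      rw [poissonMeasure_real_Ioi]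
      simp [Measure.real]
    · intro i hi
      have : i < N := Finset.mem_range.mp hi
      simp [Measure.real, this]
  · rw [Measure.dirac_prod, integral_map .of_discrete .of_discrete]
    calc ∫ n : ℕ, max ((n : ℝ) - N) 0 ∂poissonMeasure s
        ≤ ∫ n : ℕ, (1 / (4 * (N - s))) * ((n : ℝ) - s) ^ 2 ∂poissonMeasure s := by
          refine integral_mono_of_nonneg (ae_of_all _ fun n => le_max_right _ _)
            ((integrable_sq_sub_poisson s).const_mul _) (ae_of_all _ fun n => ?_)
          refine max_le ?_ (by positivity)
          beta_reduce
          rw [one_div, inv_mul_eq_div, le_div_iff₀ (by positivity)]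
          -- This is `4(N - s)(n - N) ≤ (n - s)²`; the variance `s` then bounds the tail.
          nlinarith [sq_nonneg ((n : ℝ) - s - 2 * (N - s))]
      _ = _ := by
          rw [integral_const_mul, integral_sq_sub_poisson]
          ring

/-- The variance of the annulus count is, up to a bounded error, an energy distance between
Poisson laws. -/
theorem abs_sum_poissonCdf_sub_le (x y : NNReal) {N : ℕ} (hx : (x : ℝ) < N) (hy : (y : ℝ) < N) :
    |∑ k ∈ Finset.range N, (poissonCdf k x - poissonCdf k y) *
        (1 - (poissonCdf k x - poissonCdf k y)) -
      (poissonAbsDiff x x / 2 + poissonAbsDiff y y / 2 - poissonAbsDiff y x + y - x)| ≤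
      3 * ((x : ℝ) / (4 * (N - x))) + (y : ℝ) / (4 * (N - y)) := by
  -- With `A = F_k(x)` and `B = F_k(y)`, `(A - B)(1 - (A - B)) = A(1 - A) + B(1 - B) - 2B(1 - A)`.
  have h1 := ((hasSum_poissonCdf_mul x x).add (hasSum_poissonCdf_mul y y)).sub
    ((hasSum_poissonCdf_mul y x).mul_left 2)
  have h2 : HasSum (fun k : ℕ => (poissonCdf k x - poissonCdf k y) *
        (1 - (poissonCdf k x - poissonCdf k y)))
      (poissonAbsDiff x x / 2 + poissonAbsDiff y y / 2 - poissonAbsDiff y x + y - x) := by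
    have hv : poissonAbsDiff x x / 2 + poissonAbsDiff y y / 2 - poissonAbsDiff y x + y - x =
      (poissonAbsDiff x x + x - x) / 2 + (poissonAbsDiff y y + y - y) / 2 -
        2 * ((poissonAbsDiff y x + x - y) / 2) := by ring
    rw [hv]
    exact h1.congr_fun fun k => by ring
  have h3 := (hasSum_nat_add_iff' N).mpr h2
  obtain ⟨tx, htx, hsx⟩ := hasSum_poissonCdf_tail x hx
  obtain ⟨ty, hty, hsy⟩ := hasSum_poissonCdf_tail y hy
  have h4 := (hsx.mul_left 3).add hsy
  rw [abs_sub_comm]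
  -- In the same identity, bounding the prefactors `A` and `B` by 1 gives one copy of `1 - A` from
  -- the first term, two from the last, and one `1 - B`.
  have hb : ∀ k : ℕ, |(poissonCdf (k + N) x - poissonCdf (k + N) y) *
        (1 - (poissonCdf (k + N) x - poissonCdf (k + N) y))| ≤
      3 * (1 - poissonCdf (k + N) x) + (1 - poissonCdf (k + N) y) := fun k => by
    obtain ⟨a0, a1⟩ := poissonCdf_mem_Icc x.2 (k + N)
    obtain ⟨b0, b1⟩ := poissonCdf_mem_Icc y.2 (k + N)
    simp only [NNReal.val_eq_coe] at a0 a1 b0 b1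
    set A := poissonCdf (k + N) x
    set B := poissonCdf (k + N) y
    rw [abs_le]
    constructor <;> nlinarith [mul_nonneg a0 (sub_nonneg.mpr a1), mul_nonneg b0 (sub_nonneg.mpr b1),
      mul_nonneg b0 (sub_nonneg.mpr a1), mul_nonneg (sub_nonneg.mpr b1) (sub_nonneg.mpr a1)]
  have h5 := hasSum_le (fun k => (abs_le.mp (hb k)).2) h3 h4
  have h6 := hasSum_le (fun k => (abs_le.mp (hb k)).1) h4.neg h3
  rw [abs_le]
  constructor <;> linarith

/-! ### The first absolute moment through the characteristic function. -/

theorem one_sub_cos_div_sq_le (t : ℝ) : (1 - Real.cos t) / t ^ 2 ≤ 4 * (1 + t ^ 2)⁻¹ := by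
  rcases eq_or_ne t 0 with rfl | ht
  · simp
  have h1 := Real.one_sub_sq_div_two_le_cos (x := t)
  have h2 := Real.neg_one_le_cos t
  rw [div_le_iff₀ (by positivity), mul_assoc, inv_mul_eq_div, mul_div_assoc', le_div_iff₀ (by positivity)]
  nlinarith [sq_nonneg t]

theorem one_sub_cos_div_sq_nonneg (t : ℝ) : 0 ≤ (1 - Real.cos t) / t ^ 2 :=
  div_nonneg (sub_nonneg.mpr (Real.cos_le_one t)) (sq_nonneg t)

theorem integrable_one_sub_cos_div_sq : Integrable fun t : ℝ => (1 - Real.cos t) / t ^ 2 := by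
  refine (integrable_inv_one_add_sq.const_mul 4).mono' ?_ (ae_of_all _ fun t => ?_)
  · exact Measurable.aestronglyMeasurable (by fun_prop)
  · rw [Real.norm_of_nonneg (one_sub_cos_div_sq_nonneg t)]
    exact one_sub_cos_div_sq_le t

/-- The constant `∫ (1 - cos t) / t² dt`. -/
noncomputable def absFourierConst : ℝ := ∫ t : ℝ, (1 - Real.cos t) / t ^ 2

/-- Only positivity is needed: the constant enters later as a divisor of error bounds, so its value
`π` plays no role. -/
theorem absFourierConst_pos : 0 < absFourierConst := by
  rw [absFourierConst, integral_pos_iff_support_of_nonneg one_sub_cos_div_sq_nonneg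
    integrable_one_sub_cos_div_sq]
  refine lt_of_lt_of_le ?_ (measure_mono (s := Set.Ioo 0 1) fun t ht => ?_)
  · simp
  · have h1 : Real.cos t < 1 := by
      have := Real.cos_lt_cos_of_nonneg_of_le_pi (x := 0) (y := t) le_rfl
        (by linarith [Real.pi_gt_three, ht.2]) ht.1
      simpa using this
    have : 0 < (1 - Real.cos t) / t ^ 2 := div_pos (by linarith) (pow_pos ht.1 2)
    exact this.ne'

theorem one_sub_cos_mul_div_sq (s t : ℝ) :
    (1 - Real.cos (s * t)) / t ^ 2 = s ^ 2 * ((1 - Real.cos (s * t)) / (s * t) ^ 2) := by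
  rcases eq_or_ne s 0 with rfl | hs
  · simp
  rcases eq_or_ne t 0 with rfl | ht
  · simp
  field_simp

theorem integrable_one_sub_cos_mul_div_sq (s : ℝ) :
    Integrable fun t : ℝ => (1 - Real.cos (s * t)) / t ^ 2 := by
  simp_rw [one_sub_cos_mul_div_sq s]
  rcases eq_or_ne s 0 with rfl | hs
  · simp
  exact (integrable_one_sub_cos_div_sq.comp_mul_left' hs).const_mul _

/-- Scaling by `s` represents `|s|` as a superposition of cosines, so its expectation sees only the
real part of the characteristic function. -/
theorem integral_one_sub_cos_mul_div_sq (s : ℝ) :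
    ∫ t : ℝ, (1 - Real.cos (s * t)) / t ^ 2 = absFourierConst * |s| := by
  simp_rw [one_sub_cos_mul_div_sq s]
  rw [integral_const_mul,
    Measure.integral_comp_mul_left (fun t : ℝ => (1 - Real.cos t) / t ^ 2) s, absFourierConst]
  rcases eq_or_ne s 0 with rfl | hs
  · simp
  · rw [abs_inv, ← sq_abs, smul_eq_mul]
    have : |s| ≠ 0 := abs_ne_zero.mpr hs
    field_simp

theorem integral_cos_mul_eq_re_charFun (ρ : Measure ℝ) [IsProbabilityMeasure ρ] (t : ℝ) :
    ∫ s, Real.cos (s * t) ∂ρ = (charFun ρ t).re := by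
  rw [charFun_apply_real, ← RCLike.re_eq_complex_re, ← integral_re]
  · congr 1 with s
    rw [← Complex.ofReal_mul, RCLike.re_eq_complex_re, Complex.exp_ofReal_mul_I_re, mul_comm]
  · refine Integrable.of_bound (Measurable.aestronglyMeasurable (by fun_prop)) 1
      (ae_of_all _ fun s => ?_)
    rw [← Complex.ofReal_mul, Complex.norm_exp_ofReal_mul_I]

theorem integrable_prod_one_sub_cos (ρ : Measure ℝ) [IsProbabilityMeasure ρ]
    (hρ : Integrable (fun s => s) ρ) :
    Integrable (fun p : ℝ × ℝ => (1 - Real.cos (p.1 * p.2)) / p.2 ^ 2) (ρ.prod volume) := by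
  rw [integrable_prod_iff (Measurable.aestronglyMeasurable (by fun_prop))]
  refine ⟨ae_of_all _ integrable_one_sub_cos_mul_div_sq, ?_⟩
  have h : ∀ s t : ℝ, ‖(1 - Real.cos (s * t)) / t ^ 2‖ = (1 - Real.cos (s * t)) / t ^ 2 :=
    fun s t => Real.norm_of_nonneg
      (div_nonneg (sub_nonneg.mpr (Real.cos_le_one _)) (sq_nonneg t))
  simp only [h, integral_one_sub_cos_mul_div_sq]
  exact hρ.abs.const_mul _

theorem integral_one_sub_cos_law (ρ : Measure ℝ) [IsProbabilityMeasure ρ] (t : ℝ) :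
    ∫ s, (1 - Real.cos (s * t)) / t ^ 2 ∂ρ = (1 - (charFun ρ t).re) / t ^ 2 := by
  rw [integral_div, integral_sub (integrable_const _), integral_cos_mul_eq_re_charFun]
  · simp
  · exact Integrable.of_bound (Measurable.aestronglyMeasurable (by fun_prop)) 1
      (ae_of_all _ fun s => Real.abs_cos_le_one _)

theorem integrable_one_sub_re_charFun (ρ : Measure ℝ) [IsProbabilityMeasure ρ]
    (hρ : Integrable (fun s => s) ρ) :
    Integrable fun t : ℝ => (1 - (charFun ρ t).re) / t ^ 2 := by
  have := (integrable_prod_one_sub_cos ρ hρ).integral_prod_right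
  simpa only [integral_one_sub_cos_law] using this

/-- The first absolute moment in terms of the characteristic function. -/
theorem absFourierConst_mul_integral_abs (ρ : Measure ℝ) [IsProbabilityMeasure ρ]
    (hρ : Integrable (fun s => s) ρ) :
    absFourierConst * ∫ s, |s| ∂ρ = ∫ t : ℝ, (1 - (charFun ρ t).re) / t ^ 2 := by
  rw [← integral_const_mul]
  simp_rw [← integral_one_sub_cos_mul_div_sq, ← integral_one_sub_cos_law ρ]
  exact integral_integral_swap (integrable_prod_one_sub_cos ρ hρ)

theorem abs_integral_abs_sub_le (ρ σ : Measure ℝ) [IsProbabilityMeasure ρ]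
    [IsProbabilityMeasure σ] (hρ : Integrable (fun s => s) ρ) (hσ : Integrable (fun s => s) σ)
    {g : ℝ → ℝ} (hg : Integrable g)
    (h : ∀ t, |(charFun σ t).re - (charFun ρ t).re| / t ^ 2 ≤ g t) :
    absFourierConst * |∫ s, |s| ∂ρ - ∫ s, |s| ∂σ| ≤ ∫ t, g t := by
  rw [← abs_of_pos absFourierConst_pos, ← abs_mul, mul_sub,
    absFourierConst_mul_integral_abs ρ hρ, absFourierConst_mul_integral_abs σ hσ,
    ← integral_sub (integrable_one_sub_re_charFun ρ hρ) (integrable_one_sub_re_charFun σ hσ),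
    ← Real.norm_eq_abs]
  refine norm_integral_le_of_norm_le hg (ae_of_all _ fun t => ?_)
  refine le_trans (le_of_eq ?_) (h t)
  rw [← sub_div, norm_div, Real.norm_eq_abs, Real.norm_of_nonneg (sq_nonneg t)]
  congr 2
  ring

/-! ### Gaussian approximation of Poisson differences. -/

/-- The law of the difference of independent Poisson variables of means `x` and `y`. -/
noncomputable def skellamMeasure (x y : NNReal) : Measure ℝ :=
  ((poissonMeasure x).prod (poissonMeasure y)).map fun p => (p.1 : ℝ) - p.2

instance isProbabilityMeasure_skellamMeasure (x y : NNReal) :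
    IsProbabilityMeasure (skellamMeasure x y) :=
  Measure.isProbabilityMeasure_map .of_discrete

theorem integrable_id_skellamMeasure (x y : NNReal) :
    Integrable (fun s => s) (skellamMeasure x y) := by
  rw [skellamMeasure, integrable_map_measure (by fun_prop) .of_discrete]
  exact integrable_sub_poisson x y

theorem integral_abs_skellamMeasure (x y : NNReal) :
    ∫ s, |s| ∂skellamMeasure x y = poissonAbsDiff x y := by
  rw [skellamMeasure, integral_map .of_discrete (by fun_prop), poissonAbsDiff]

theorem charFun_skellamMeasure (x y : NNReal) (t : ℝ) :
    charFun (skellamMeasure x y) t =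
      Complex.exp (x * (Complex.exp (t * Complex.I) - 1)) *
        Complex.exp (y * (Complex.exp ((-t : ℝ) * Complex.I) - 1)) := by
  rw [← charFun_map_cast_poissonMeasure, ← charFun_map_cast_poissonMeasure, charFun_apply_real,
    charFun_apply_real, charFun_apply_real, skellamMeasure,
    integral_map .of_discrete (by fun_prop), integral_map .of_discrete (by fun_prop),
    integral_map .of_discrete (by fun_prop), ← integral_prod_mul]
  congr 1 with p
  rw [← Complex.exp_add]
  congr 1
  push_cast
  ring

theorem re_charFun_skellamMeasure (x y : NNReal) (t : ℝ) :
    (charFun (skellamMeasure x y) t).re =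
      Real.exp (-((x + y : ℝ) * (1 - Real.cos t))) * Real.cos ((x - y : ℝ) * Real.sin t) := by
  rw [charFun_skellamMeasure, ← Complex.exp_add, Complex.exp_re]
  have h1 : ∀ u : ℝ, (Complex.exp (u * Complex.I)).re = Real.cos u := Complex.exp_ofReal_mul_I_re
  have h2 : ∀ u : ℝ, (Complex.exp (u * Complex.I)).im = Real.sin u := Complex.exp_ofReal_mul_I_im
  congr 2
  · simp [Complex.add_re, Complex.mul_re, h1, h2, -Complex.ofReal_neg]
    ring
  · simp [Complex.add_im, Complex.mul_im, h1, h2, -Complex.ofReal_neg]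
    ring

theorem re_charFun_gaussianReal (m : ℝ) (v : NNReal) (t : ℝ) :
    (charFun (gaussianReal m v) t).re = Real.exp (-(v * (t ^ 2 / 2))) * Real.cos (m * t) := by
  rw [charFun_gaussianReal, Complex.exp_re]
  congr 2
  · simp [Complex.sub_re, Complex.mul_re, ← Complex.ofReal_pow]
    ring
  · simp [Complex.sub_im, Complex.mul_im, ← Complex.ofReal_pow]
    ring

theorem abs_exp_neg_sub_exp_neg_le {p q r : ℝ} (hp : r ≤ p) (hq : r ≤ q) :
    |Real.exp (-p) - Real.exp (-q)| ≤ Real.exp (-r) * |p - q| := by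
  wlog hpq : p ≤ q generalizing p q
  · rw [abs_sub_comm, abs_sub_comm p q]
    exact this hq hp (le_of_not_ge hpq)
  rw [abs_of_nonneg (sub_nonneg.mpr (Real.exp_le_exp.mpr (by linarith))),
    abs_of_nonpos (by linarith)]
  have h1 : Real.exp (-q) = Real.exp (-p) * Real.exp (p - q) := by
    rw [← Real.exp_add]; ring_nf
  have h2 := Real.add_one_le_exp (p - q)
  have h3 : Real.exp (-p) ≤ Real.exp (-r) := Real.exp_le_exp.mpr (by linarith)
  rw [h1]
  nlinarith [Real.exp_pos (-p)]

theorem abs_cos_sub_cos_le (p q : ℝ) : |Real.cos p - Real.cos q| ≤ |p - q| := by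
  simpa [dist_eq_norm] using Real.lipschitzWith_cos.dist_le_mul p q

/-- For `|t| ≤ 1` the Taylor errors of `1 - cos t` and `sin t` are at most `|t|³`, and both `t² / 2`
and `1 - cos t` are at least `t² / 4`. The Gaussian decay is kept because it must absorb the factor
`x + y` after integration. -/
theorem abs_skellam_sub_gaussian_le {x y t : ℝ} (hx : 0 ≤ x) (hy : 0 ≤ y) (ht : |t| ≤ 1) :
    |Real.exp (-((x + y) * (t ^ 2 / 2))) * Real.cos ((x - y) * t) -
      Real.exp (-((x + y) * (1 - Real.cos t))) * Real.cos ((x - y) * Real.sin t)| ≤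
      2 * (x + y) * |t| ^ 3 * Real.exp (-((x + y) * (t ^ 2 / 4))) := by
  have h0 : 0 ≤ |t| := abs_nonneg t
  have hs : t ^ 2 = |t| ^ 2 := (sq_abs t).symm
  have hc := Real.cos_bound ht
  have hsn := Real.sin_bound ht
  have h43 : |t| ^ 4 ≤ |t| ^ 3 := pow_le_pow_of_le_one h0 ht (by norm_num)
  have h53 : |t| ^ 5 ≤ |t| ^ 3 := pow_le_pow_of_le_one h0 ht (by norm_num)
  have h42 : |t| ^ 4 ≤ |t| ^ 2 := pow_le_pow_of_le_one h0 ht (by norm_num)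
  have hpos3 : 0 ≤ |t| ^ 3 := by positivity
  have hcos : |t ^ 2 / 2 - (1 - Real.cos t)| ≤ |t| ^ 3 := by
    have e : t ^ 2 / 2 - (1 - Real.cos t) = Real.cos t - (1 - t ^ 2 / 2) := by ring
    rw [e]
    linarith
  have hsin : |t - Real.sin t| ≤ |t| ^ 3 := by
    have e : t - Real.sin t = -(Real.sin t - (t - t ^ 3 / 6)) + t ^ 3 / 6 := by ring
    rw [e]
    refine (abs_add_le _ _).trans ?_
    rw [abs_neg, abs_div, abs_pow]
    norm_num
    linarith
  have hlow : t ^ 2 / 4 ≤ 1 - Real.cos t := by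
    have := (abs_le.mp hc).2
    rw [hs] at this ⊢
    linarith [sq_nonneg |t|]
  have hv : 0 ≤ x + y := by linarith
  set E := Real.exp (-((x + y) * (t ^ 2 / 4))) with hE
  have hE0 : 0 < E := Real.exp_pos _
  have h1 : |Real.exp (-((x + y) * (t ^ 2 / 2))) - Real.exp (-((x + y) * (1 - Real.cos t)))| ≤
      E * ((x + y) * |t| ^ 3) := by
    refine (abs_exp_neg_sub_exp_neg_le (r := (x + y) * (t ^ 2 / 4))
      (mul_le_mul_of_nonneg_left (by nlinarith [sq_nonneg t]) hv)
      (mul_le_mul_of_nonneg_left hlow hv)).trans ?_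
    rw [← mul_sub, abs_mul, abs_of_nonneg hv]
    gcongr
  have h2 : |Real.cos ((x - y) * t) - Real.cos ((x - y) * Real.sin t)| ≤ (x + y) * |t| ^ 3 := by
    refine (abs_cos_sub_cos_le _ _).trans ?_
    rw [← mul_sub, abs_mul]
    gcongr
    exact abs_le.mpr ⟨by linarith, by linarith⟩
  have h3 : Real.exp (-((x + y) * (t ^ 2 / 2))) ≤ E :=
    Real.exp_le_exp.mpr (by nlinarith [mul_nonneg hv (sq_nonneg t)])
  have e : Real.exp (-((x + y) * (t ^ 2 / 2))) * Real.cos ((x - y) * t) -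
      Real.exp (-((x + y) * (1 - Real.cos t))) * Real.cos ((x - y) * Real.sin t) =
      Real.exp (-((x + y) * (t ^ 2 / 2))) *
        (Real.cos ((x - y) * t) - Real.cos ((x - y) * Real.sin t)) +
      (Real.exp (-((x + y) * (t ^ 2 / 2))) - Real.exp (-((x + y) * (1 - Real.cos t)))) *
        Real.cos ((x - y) * Real.sin t) := by ring
  rw [e]
  refine (abs_add_le _ _).trans ?_
  rw [abs_mul, abs_mul, Real.abs_exp]
  have h4 := mul_le_mul h3 h2 (abs_nonneg _) hE0.le
  have h5 := mul_le_mul h1 (Real.abs_cos_le_one ((x - y) * Real.sin t)) (abs_nonneg _)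
    (by positivity)
  linarith

/-- The first term handles `|t| ≤ 1`. For `|t| ≥ 1` both characteristic functions are bounded by 1,
and `2 / t² ≤ 4 / (1 + t²)`. -/
theorem abs_charFun_sub_div_sq_le (x y : NNReal) (t : ℝ) :
    |(charFun (gaussianReal (x - y : ℝ) (x + y)) t).re - (charFun (skellamMeasure x y) t).re| /
      t ^ 2 ≤ 2 * (x + y : ℝ) * (|t| * Real.exp (-((x + y : ℝ) / 4) * |t| ^ 2)) +
        4 * (1 + t ^ 2)⁻¹ := by
  have hpos : (0 : ℝ) < 1 + t ^ 2 := by positivity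
  have hA : 0 ≤ 2 * (x + y : ℝ) * (|t| * Real.exp (-((x + y : ℝ) / 4) * |t| ^ 2)) := by positivity
  have hB : 0 ≤ 4 * (1 + t ^ 2)⁻¹ := by positivity
  rcases eq_or_ne t 0 with rfl | h0
  · simp
  have ht2 : 0 < t ^ 2 := by positivity
  rcases le_total |t| 1 with ht | ht
  · rw [re_charFun_gaussianReal, re_charFun_skellamMeasure, NNReal.coe_add]
    refine le_add_of_le_of_nonneg ?_ hB
    rw [div_le_iff₀ ht2]
    refine (abs_skellam_sub_gaussian_le x.2 y.2 ht).trans (le_of_eq ?_)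
    have e : -((x + y : ℝ) / 4) * |t| ^ 2 = -((x + y : ℝ) * (t ^ 2 / 4)) := by
      rw [sq_abs]; ring
    rw [e, ← sq_abs t]
    simp only [NNReal.val_eq_coe]
    ring
  · refine le_add_of_nonneg_of_le hA ?_
    have h1 : ∀ (ρ : Measure ℝ) [IsProbabilityMeasure ρ], |(charFun ρ t).re| ≤ 1 := fun ρ _ =>
      (Complex.abs_re_le_norm _).trans (norm_charFun_le_one t)
    have h2 := (abs_sub _ _).trans (add_le_add (h1 (gaussianReal (x - y : ℝ) (x + y)))
      (h1 (skellamMeasure x y)))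
    have h3 : 1 ≤ t ^ 2 := by
      rw [← sq_abs]; nlinarith
    rw [div_le_iff₀ ht2, mul_assoc, inv_mul_eq_div, mul_div_assoc', le_div_iff₀ hpos]
    nlinarith [abs_nonneg ((charFun (gaussianReal (x - y : ℝ) (x + y)) t).re -
      (charFun (skellamMeasure x y) t).re)]

theorem integral_abs_mul_exp_neg_mul_sq {b : ℝ} (hb : 0 < b) :
    ∫ t : ℝ, |t| * Real.exp (-b * |t| ^ 2) = b⁻¹ := by
  rw [integral_comp_abs (f := fun t => t * Real.exp (-b * t ^ 2)),
    integral_Ioi_of_hasDerivAt_of_nonneg' (g := fun t => -(1 / (2 * b)) * Real.exp (-b * t ^ 2))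
      (l := 0)]
  · simp
    field_simp
  · intro t _
    have h := (((hasDerivAt_pow 2 t).const_mul (-b)).exp).const_mul (-(1 / (2 * b)))
    refine h.congr_deriv ?_
    field_simp
    simp
  · intro t ht
    have : (0 : ℝ) < t := ht
    positivity
  · have h2 : Tendsto (fun t : ℝ => b * t ^ 2) atTop atTop :=
      (tendsto_pow_atTop two_ne_zero).const_mul_atTop hb
    have h3 := (Real.tendsto_exp_neg_atTop_nhds_zero.comp h2).const_mul (-(1 / (2 * b)))
    simpa using h3

theorem integrable_abs_mul_exp_neg_mul_sq {b : ℝ} (hb : 0 < b) :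
    Integrable fun t : ℝ => |t| * Real.exp (-b * |t| ^ 2) := by
  simpa [abs_mul] using (integrable_mul_exp_neg_mul_sq hb).abs

theorem integrable_id_gaussianReal (m : ℝ) (v : NNReal) :
    Integrable (fun s => s) (gaussianReal m v) :=
  (memLp_id_gaussianReal (μ := m) (v := v) 1).integrable le_rfl

/-- Replacing a difference of Poisson variables by a Gaussian costs only a bounded error in the
mean absolute value. -/
theorem abs_poissonAbsDiff_sub_gaussian_le {x y : NNReal} (hxy : 0 < x + y) :
    absFourierConst * |poissonAbsDiff x y - ∫ s, |s| ∂gaussianReal (x - y : ℝ) (x + y)| ≤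
      8 + 4 * Real.pi := by
  have hv : (0 : ℝ) < x + y := by exact_mod_cast hxy
  have hb : (0 : ℝ) < (x + y : ℝ) / 4 := by positivity
  rw [← integral_abs_skellamMeasure]
  refine (abs_integral_abs_sub_le _ _ (integrable_id_skellamMeasure x y)
    (integrable_id_gaussianReal _ _)
    (((integrable_abs_mul_exp_neg_mul_sq hb).const_mul _).add
      (integrable_inv_one_add_sq.const_mul 4)) (abs_charFun_sub_div_sq_le x y)).trans ?_
  simp only [Pi.add_apply]
  rw [integral_add ((integrable_abs_mul_exp_neg_mul_sq hb).const_mul _)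
    (integrable_inv_one_add_sq.const_mul 4), integral_const_mul, integral_const_mul,
    integral_abs_mul_exp_neg_mul_sq hb, integral_univ_inv_one_add_sq]
  -- With `v = x + y` the first term is `2v · (4 / v) = 8`, independent of the means; the second is
  -- `4π`.
  refine le_of_eq ?_
  field_simp
  ring

/-! ### Truncated absolute moments of the standard Gaussian. -/

theorem gaussianReal_eq_map_std (m : ℝ) (v : NNReal) :
    gaussianReal m v = (gaussianReal 0 1).map fun z => √(v : ℝ) * z + m := by
  have h : (fun z : ℝ => √(v : ℝ) * z + m) = (fun z => z + m) ∘ fun z => √(v : ℝ) * z := rfl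
  rw [h, ← Measure.map_map (by fun_prop) (by fun_prop), gaussianReal_map_const_mul,
    gaussianReal_map_add_const]
  congr 1
  · simp
  · ext
    simp

/-- `E min(T, |Z|)` for a standard Gaussian `Z`. -/
noncomputable def gaussMin (T : ℝ) : ℝ := ∫ z, min T |z| ∂gaussianReal 0 1

/-- `E |Z|` for a standard Gaussian `Z`. -/
noncomputable def gaussAbs : ℝ := ∫ z, |z| ∂gaussianReal 0 1

theorem integrable_abs_std : Integrable (fun z : ℝ => |z|) (gaussianReal 0 1) :=
  (integrable_id_gaussianReal 0 1).abs

theorem integrable_min_abs_std (T : ℝ) : Integrable (fun z : ℝ => min T |z|) (gaussianReal 0 1) :=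
  (integrable_const T).inf integrable_abs_std

theorem gaussAbs_eq : gaussAbs = √2 / √Real.pi := by
  rw [gaussAbs, integral_gaussianReal_eq_integral_smul one_ne_zero]
  have h := integral_abs_mul_exp_neg_mul_sq (b := 1 / 2) (by norm_num)
  have e : ∀ z : ℝ, gaussianPDFReal 0 1 z • |z| =
      (√(2 * Real.pi))⁻¹ * (|z| * Real.exp (-(1 / 2) * |z| ^ 2)) := fun z => by
    rw [gaussianPDFReal, sq_abs]
    simp only [NNReal.coe_one, mul_one, sub_zero, smul_eq_mul]
    rw [show -z ^ 2 / 2 = -(1 / 2) * z ^ 2 by ring]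
    ring
  simp_rw [e]
  rw [integral_const_mul, h, Real.sqrt_mul (by norm_num)]
  have h2 : √(2 : ℝ) ≠ 0 := by positivity
  have h3 : √Real.pi ≠ 0 := by positivity
  have h4 : √(2 : ℝ) ^ 2 = 2 := Real.sq_sqrt (by norm_num)
  field_simp
  linarith

theorem gaussAbs_pos : 0 < gaussAbs := by
  rw [gaussAbs_eq]; positivity

/-- By symmetry `|z + t|` may be averaged with `|z - t|`, and `|z + t| + |z - t| = 2 max(|z|, t) =
2(|z| + t - min(t, |z|))`. -/
theorem integral_abs_add_std {t : ℝ} (ht : 0 ≤ t) :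
    ∫ z, |z + t| ∂gaussianReal 0 1 = gaussAbs + t - gaussMin t := by
  have hint : ∀ s : ℝ, Integrable (fun z : ℝ => |z + s|) (gaussianReal 0 1) := fun s =>
    ((integrable_id_gaussianReal 0 1).add (integrable_const s)).abs
  have hneg : ∫ z, |z + -t| ∂gaussianReal 0 1 = ∫ z, |z + t| ∂gaussianReal 0 1 := by
    conv_lhs => rw [← neg_zero, ← gaussianReal_map_neg]
    rw [integral_map (by fun_prop) (by fun_prop)]
    congr 1 with z
    rw [← abs_neg]
    ring_nf
  have hsum : ∀ z : ℝ, |z + t| + |z + -t| = 2 * (|z| + t - min t |z|) := fun z => by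
    rcases abs_cases (z + t) with ⟨h1, _⟩ | ⟨h1, _⟩ <;>
    rcases abs_cases (z + -t) with ⟨h2, _⟩ | ⟨h2, _⟩ <;>
    rcases abs_cases z with ⟨h3, _⟩ | ⟨h3, _⟩ <;>
    rcases min_cases t |z| with ⟨h4, _⟩ | ⟨h4, _⟩ <;> rw [h4, h1, h2] <;> linarith
  have h1 := integral_add (hint t) (hint (-t))
  simp_rw [hsum] at h1
  rw [hneg, integral_const_mul,
    integral_sub (by exact integrable_abs_std.add (integrable_const t)) (integrable_min_abs_std t),
    integral_add integrable_abs_std (integrable_const t)] at h1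
  simp only [integral_const, probReal_univ, smul_eq_mul, one_mul] at h1
  rw [gaussAbs, gaussMin]
  linarith

theorem integral_abs_gaussianReal {m : ℝ} (hm : 0 ≤ m) {v : NNReal} (hv : 0 < v) :
    ∫ s, |s| ∂gaussianReal m v =
      √(v : ℝ) * gaussAbs + m - √(v : ℝ) * gaussMin (m / √(v : ℝ)) := by
  have hs : 0 < √(v : ℝ) := Real.sqrt_pos.mpr (by exact_mod_cast hv)
  rw [gaussianReal_eq_map_std, integral_map (by fun_prop) (by fun_prop)]
  have e : ∀ z : ℝ, |√(v : ℝ) * z + m| = √(v : ℝ) * |z + m / √(v : ℝ)| := fun z => by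
    rw [← abs_of_pos hs, ← abs_mul, abs_of_pos hs]
    congr 1
    field_simp
  simp_rw [e]
  rw [integral_const_mul, integral_abs_add_std (by positivity)]
  field_simp

theorem gaussMin_zero : gaussMin 0 = 0 := by
  simp [gaussMin]

theorem gaussMin_nonneg {T : ℝ} (hT : 0 ≤ T) : 0 ≤ gaussMin T :=
  integral_nonneg fun z => le_min hT (abs_nonneg z)

theorem gaussMin_le_gaussAbs (T : ℝ) : gaussMin T ≤ gaussAbs :=
  integral_mono (integrable_min_abs_std T) integrable_abs_std fun _ => min_le_right _ _

theorem gaussMin_le (T : ℝ) : gaussMin T ≤ T := by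
  have := integral_mono (integrable_min_abs_std T) (integrable_const T) fun _ => min_le_left _ _
  rw [integral_const, probReal_univ, one_smul] at this
  exact this

theorem abs_gaussMin_sub_le (S T : ℝ) : |gaussMin S - gaussMin T| ≤ |S - T| := by
  rw [gaussMin, gaussMin, ← integral_sub (integrable_min_abs_std S) (integrable_min_abs_std T),
    ← Real.norm_eq_abs]
  have h := norm_integral_le_of_norm_le_const (μ := gaussianReal 0 1) (C := |S - T|)
    (f := fun z => min S |z| - min T |z|) (ae_of_all _ fun z => by
      have := abs_min_sub_min_le_max S |z| T |z|
      simpa using this)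
  simpa using h

/-- The integrand is `(|z| - T)⁺ ≤ z² / (4T)`, and the second moment is 1. -/
theorem gaussAbs_sub_gaussMin_le {T : ℝ} (hT : 0 < T) : gaussAbs - gaussMin T ≤ 1 / (4 * T) := by
  have hsq : Integrable (fun z : ℝ => z ^ 2) (gaussianReal 0 1) :=
    (memLp_id_gaussianReal (μ := 0) (v := 1) 2).integrable_sq
  have h1 : ∫ z, z ^ 2 ∂gaussianReal 0 1 = 1 := by
    have h := variance_fun_id_gaussianReal (μ := 0) (v := 1)
    rw [variance_eq_integral (by fun_prop), integral_id_gaussianReal] at h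
    simpa using h
  rw [gaussAbs, gaussMin, ← integral_sub integrable_abs_std (integrable_min_abs_std T)]
  have h2 : ∫ z, (|z| - min T |z|) ∂gaussianReal 0 1 ≤
      ∫ z, (1 / (4 * T)) * z ^ 2 ∂gaussianReal 0 1 := by
    refine integral_mono (integrable_abs_std.sub (integrable_min_abs_std T)) (hsq.const_mul _)
      fun z => ?_
    have h0 : 0 ≤ (1 / (4 * T)) * z ^ 2 := by positivity
    beta_reduce
    rcases min_cases T |z| with ⟨h, _⟩ | ⟨h, _⟩
    · rw [h, one_div, inv_mul_eq_div, le_div_iff₀ (by positivity), ← sq_abs z]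
      nlinarith [sq_nonneg (|z| - 2 * T)]
    · rw [h, sub_self]; exact h0
  rw [integral_const_mul, h1, mul_one] at h2
  exact h2

theorem gaussianPDFReal_std_le (z : ℝ) : gaussianPDFReal 0 1 z ≤ 1 / 2 := by
  rw [gaussianPDFReal]
  have h1 : (2 : ℝ) ≤ √(2 * Real.pi * (1 : NNReal)) := by
    apply Real.le_sqrt_of_sq_le
    simp only [NNReal.coe_one, mul_one]
    linarith [Real.pi_gt_three]
  have h2 : Real.exp (-(z - 0) ^ 2 / (2 * ((1 : NNReal) : ℝ))) ≤ 1 :=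
    Real.exp_le_one_iff.mpr (by
      apply div_nonpos_of_nonpos_of_nonneg
      · nlinarith [sq_nonneg (z - 0)]
      · simp)
  calc _ ≤ (2 : ℝ)⁻¹ * 1 := by gcongr
    _ = _ := by norm_num

theorem gaussianReal_real_Ioo_le {T : ℝ} (hT : 0 ≤ T) :
    (gaussianReal 0 1).real (Set.Ioo (-T) T) ≤ T := by
  have h0 : 0 ≤ ∫ z in Set.Ioo (-T) T, gaussianPDFReal 0 1 z :=
    integral_nonneg fun z => gaussianPDFReal_nonneg _ _ _
  rw [Measure.real, gaussianReal_apply_eq_integral 0 one_ne_zero, ENNReal.toReal_ofReal h0]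
  refine (le_abs_self _).trans ?_
  have h := norm_setIntegral_le_of_norm_le_const (μ := volume) (s := Set.Ioo (-T) T)
    (f := gaussianPDFReal 0 1) (C := 1 / 2) (by simp) (fun z _ => by
      rw [Real.norm_of_nonneg (gaussianPDFReal_nonneg _ _ _)]
      exact gaussianPDFReal_std_le z)
  rw [Real.volume_real_Ioo_of_le (by linarith), Real.norm_eq_abs] at h
  linarith

/-- The loss `T - min(T, |z|)` is at most `T` and vanishes unless `|z| < T`, an event of probability
at most `T` since the density is at most `1/2`. -/
theorem sub_gaussMin_le {T : ℝ} (hT : 0 ≤ T) : T - gaussMin T ≤ T ^ 2 := by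
  have h1 : ∫ z, (T - min T |z|) ∂gaussianReal 0 1 ≤
      ∫ z, (Set.Ioo (-T) T).indicator (fun _ => T) z ∂gaussianReal 0 1 := by
    refine integral_mono ((integrable_const T).sub (integrable_min_abs_std T))
      ((integrable_const T).indicator measurableSet_Ioo) fun z => ?_
    beta_reduce
    by_cases hz : z ∈ Set.Ioo (-T) T
    · rw [Set.indicator_of_mem hz]
      linarith [le_min hT (abs_nonneg z)]
    · rw [Set.indicator_of_notMem hz]
      have : T ≤ |z| := by
        by_contra hc
        exact hz (abs_lt.mp (not_le.mp hc))
      rw [min_eq_left this, sub_self]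
  rw [integral_sub (integrable_const T) (integrable_min_abs_std T),
    integral_indicator_const _ measurableSet_Ioo] at h1
  simp only [integral_const, probReal_univ, smul_eq_mul, one_mul] at h1
  rw [gaussMin]
  nlinarith [gaussianReal_real_Ioo_le hT]

/-! ### Closed form and limits of `Imod`. -/

theorem gaussWindow_eq {c : ℝ} (hc : 0 ≤ c) (x : ℝ) :
    gaussWindow c x = (gaussianReal 0 1).real (Set.Icc x (2 * c + x)) := by
  have h0 : 0 ≤ ∫ z in Set.Icc x (2 * c + x), gaussianPDFReal 0 1 z :=
    integral_nonneg fun z => gaussianPDFReal_nonneg _ _ _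
  rw [Measure.real, gaussianReal_apply_eq_integral 0 one_ne_zero, ENNReal.toReal_ofReal h0,
    gaussWindow, intervalIntegral.integral_of_le (by linarith), ← integral_Icc_eq_integral_Ioc]
  congr 1 with z
  simp only [gaussianPDFReal, NNReal.coe_one, mul_one, sub_zero]
  rw [div_eq_inv_mul]

theorem volume_real_Icc_diff {c : ℝ} (hc : 0 ≤ c) (z w : ℝ) :
    volume.real (Set.Icc (z - 2 * c) z \ Set.Icc (w - 2 * c) w) = min (2 * c) |z - w| := by
  have h := measureReal_sdiff_add_inter (μ := volume) (s := Set.Icc (z - 2 * c) z)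
    (t := Set.Icc (w - 2 * c) w) measurableSet_Icc
    (by rw [Real.volume_Icc]; exact ENNReal.ofReal_ne_top)
  rw [Set.Icc_inter_Icc, Real.volume_real_Icc, Real.volume_real_Icc] at h
  rw [eq_sub_of_add_eq h]
  have e : max (z - (z - 2 * c)) 0 = 2 * c := by
    rw [sub_sub_cancel, max_eq_left (by linarith)]
  rw [e]
  rcases le_total z w with hzw | hzw
  · rw [sup_eq_right.mpr (by linarith : z - 2 * c ≤ w - 2 * c), inf_eq_left.mpr hzw,
      abs_of_nonpos (by linarith)]
    rcases le_total (2 * c) (w - z) with h1 | h1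
    · rw [max_eq_right (by linarith), min_eq_left (by linarith)]; ring
    · rw [max_eq_left (by linarith), min_eq_right (by linarith)]; ring
  · rw [sup_eq_left.mpr (by linarith : w - 2 * c ≤ z - 2 * c), inf_eq_right.mpr hzw,
      abs_of_nonneg (by linarith)]
    rcases le_total (2 * c) (z - w) with h1 | h1
    · rw [max_eq_right (by linarith), min_eq_left (by linarith)]; ring
    · rw [max_eq_left (by linarith), min_eq_right (by linarith)]; ring

theorem map_sub_std_prod_std :
    ((gaussianReal 0 1).prod (gaussianReal 0 1)).map (fun p : ℝ × ℝ => p.1 - p.2) =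
      gaussianReal 0 2 := by
  have h := gaussianReal_conv_gaussianReal (m₁ := 0) (m₂ := 0) (v₁ := 1) (v₂ := 1)
  rw [Measure.conv] at h
  nth_rewrite 2 [← neg_zero] at h
  rw [← gaussianReal_map_neg] at h
  nth_rewrite 1 [← Measure.map_id (μ := gaussianReal 0 1)] at h
  rw [Measure.map_prod_map _ _ (by fun_prop) (by fun_prop),
    Measure.map_map (by fun_prop) (by fun_prop)] at h
  rw [zero_add, one_add_one_eq_two] at h
  rw [← h]
  rfl

theorem integral_min_abs_sub_std (c : ℝ) :
    ∫ p, min (2 * c) |p.1 - p.2| ∂((gaussianReal 0 1).prod (gaussianReal 0 1)) =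
      √2 * gaussMin (√2 * c) := by
  have h2 : √(2 : ℝ) * √2 = 2 := Real.mul_self_sqrt (by norm_num)
  have h := integral_map (μ := (gaussianReal 0 1).prod (gaussianReal 0 1))
    (φ := fun p : ℝ × ℝ => p.1 - p.2) (f := fun d => min (2 * c) |d|) (by fun_prop) (by fun_prop)
  rw [← h, map_sub_std_prod_std, gaussianReal_eq_map_std,
    integral_map (by fun_prop) (by fun_prop), gaussMin, ← integral_const_mul]
  congr 1 with z
  simp only [NNReal.coe_ofNat, add_zero]
  rw [mul_min_of_nonneg _ _ (Real.sqrt_nonneg 2), ← mul_assoc, h2, abs_mul,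
    abs_of_nonneg (Real.sqrt_nonneg 2)]

/-- The points `(x, (z, w))` such that `z` lies in the window `[x, 2c + x]` and `w` does not. -/
def windowSet (c : ℝ) : Set (ℝ × ℝ × ℝ) :=
  {p | p.2.1 ∈ Set.Icc p.1 (2 * c + p.1) ∧ p.2.2 ∉ Set.Icc p.1 (2 * c + p.1)}

theorem measurableSet_windowSet (c : ℝ) : MeasurableSet (windowSet c) := by
  have key : ∀ f : ℝ × ℝ × ℝ → ℝ, Measurable f →
      MeasurableSet {p : ℝ × ℝ × ℝ | f p ∈ Set.Icc p.1 (2 * c + p.1)} := fun f hf => by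
    have h : {p : ℝ × ℝ × ℝ | f p ∈ Set.Icc p.1 (2 * c + p.1)} =
        {p | p.1 ≤ f p} ∩ {p | f p ≤ 2 * c + p.1} := by
      ext p; simp
    rw [h]
    exact (measurableSet_le measurable_fst hf).inter
      (measurableSet_le hf (measurable_fst.const_add _))
  have h : windowSet c = {p : ℝ × ℝ × ℝ | p.2.1 ∈ Set.Icc p.1 (2 * c + p.1)} ∩
      {p : ℝ × ℝ × ℝ | p.2.2 ∈ Set.Icc p.1 (2 * c + p.1)}ᶜ := by
    ext p; simp [windowSet]
  rw [h]
  exact (key _ (by fun_prop)).inter (key _ (by fun_prop)).compl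

/-- Integrated over `x` first, the set has as slices the differences of two intervals of length `2c`
shifted by `|z - w|`. Integrated over `(z, w)` first, it gives `q(1 - q)` by independence. Equating
the two orders evaluates `Imod`. -/
theorem integral_windowSet_fst {c : ℝ} (hc : 0 ≤ c) (p : ℝ × ℝ) :
    ∫ x, (windowSet c).indicator (fun _ => (1 : ℝ)) (x, p) = min (2 * c) |p.1 - p.2| := by
  have e : ∀ x, (windowSet c).indicator (fun _ => (1 : ℝ)) (x, p) =
      (Set.Icc (p.1 - 2 * c) p.1 \ Set.Icc (p.2 - 2 * c) p.2).indicator 1 x := fun x => by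
    have hiff : ∀ w : ℝ, w ∈ Set.Icc x (2 * c + x) ↔ x ∈ Set.Icc (w - 2 * c) w := fun w => by
      simp only [Set.mem_Icc]
      constructor <;> rintro ⟨h1, h2⟩ <;> constructor <;> linarith
    simp only [windowSet, Set.indicator, Set.mem_ofPred_eq, hiff, Set.mem_sdiff, Pi.one_apply]
  simp_rw [e]
  rw [integral_indicator_one (measurableSet_Icc.diff measurableSet_Icc), volume_real_Icc_diff hc]

theorem integral_windowSet_snd {c : ℝ} (hc : 0 ≤ c) (x : ℝ) :
    ∫ p, (windowSet c).indicator (fun _ => (1 : ℝ)) (x, p)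
      ∂((gaussianReal 0 1).prod (gaussianReal 0 1)) = gaussWindow c x - gaussWindow c x ^ 2 := by
  have e : ∀ p : ℝ × ℝ, (windowSet c).indicator (fun _ => (1 : ℝ)) (x, p) =
      (Set.Icc x (2 * c + x) ×ˢ (Set.Icc x (2 * c + x))ᶜ).indicator 1 p := fun p => by
    simp only [windowSet, Set.indicator, Set.mem_ofPred_eq, Set.mem_prod, Set.mem_compl_iff,
      Pi.one_apply]
    congr
  simp_rw [e]
  rw [integral_indicator_one (measurableSet_Icc.prod measurableSet_Icc.compl),
    measureReal_prod_prod, probReal_compl_eq_one_sub measurableSet_Icc, gaussWindow_eq hc]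
  ring

/-- Integrating over `x` first leaves a function bounded by `2c` on a probability space; convergence
of the integral defining `Imod` follows. -/
theorem integrable_windowSet {c : ℝ} (hc : 0 ≤ c) :
    Integrable ((windowSet c).indicator fun _ => (1 : ℝ))
      ((volume : Measure ℝ).prod ((gaussianReal 0 1).prod (gaussianReal 0 1))) := by
  have hm : Measurable ((windowSet c).indicator fun _ => (1 : ℝ)) :=
    measurable_const.indicator (measurableSet_windowSet c)
  have hn : ∀ q, ‖(windowSet c).indicator (fun _ => (1 : ℝ)) q‖ =
      (windowSet c).indicator (fun _ => (1 : ℝ)) q := fun q =>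
    Real.norm_of_nonneg (Set.indicator_nonneg (fun _ _ => zero_le_one) _)
  rw [integrable_prod_iff' hm.aestronglyMeasurable]
  constructor
  · refine ae_of_all _ fun p => ?_
    have hfin : Integrable ((Set.Icc (p.1 - 2 * c) p.1).indicator fun _ => (1 : ℝ)) :=
      (integrable_indicator_iff measurableSet_Icc).mpr
        (integrableOn_const (by rw [Real.volume_Icc]; exact ENNReal.ofReal_ne_top))
    refine hfin.mono' (hm.comp (by fun_prop)).aestronglyMeasurable (ae_of_all _ fun x => ?_)
    rw [hn]
    by_cases hx : (x, p) ∈ windowSet c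
    · have : x ∈ Set.Icc (p.1 - 2 * c) p.1 := by
        obtain ⟨⟨h1, h2⟩, _⟩ := hx
        simp only at h1 h2
        exact ⟨by linarith, h1⟩
      rw [Set.indicator_of_mem hx, Set.indicator_of_mem this]
    · rw [Set.indicator_of_notMem hx]
      exact Set.indicator_nonneg (fun _ _ => zero_le_one) _
  · simp only [hn, integral_windowSet_fst hc]
    refine Integrable.of_bound (Measurable.aestronglyMeasurable (by fun_prop)) (2 * c)
      (ae_of_all _ fun p => ?_)
    rw [Real.norm_of_nonneg (le_min (by linarith) (abs_nonneg _))]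
    exact min_le_left _ _

theorem integrable_gaussWindow_sub_sq {c : ℝ} (hc : 0 ≤ c) :
    Integrable fun x : ℝ => gaussWindow c x - gaussWindow c x ^ 2 := by
  have h := (integrable_windowSet hc).integral_prod_left
  simpa only [integral_windowSet_snd hc] using h

/-- Closed form of `Imod` in terms of a truncated Gaussian moment. -/
theorem Imod_eq {c : ℝ} (hc : 0 ≤ c) : Imod c = √Real.pi * (√2 * gaussMin (√2 * c)) := by
  rw [Imod, ← integral_min_abs_sub_std]
  congr 1
  simp_rw [← integral_windowSet_snd hc, ← integral_windowSet_fst hc]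
  exact integral_integral_swap (f := fun x p => (windowSet c).indicator (fun _ => (1 : ℝ)) (x, p))
    (integrable_windowSet hc)

theorem tendsto_gaussMin_atTop : Tendsto gaussMin atTop (𝓝 gaussAbs) := by
  have h1 : Tendsto (fun T : ℝ => gaussAbs - 1 / (4 * T)) atTop (𝓝 gaussAbs) := by
    have h : Tendsto (fun T : ℝ => 4 * T) atTop atTop :=
      tendsto_id.const_mul_atTop (by norm_num)
    simpa using (tendsto_const_nhds (x := gaussAbs)).sub h.inv_tendsto_atTop
  refine tendsto_of_tendsto_of_tendsto_of_le_of_le' h1 tendsto_const_nhds ?_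
    (Eventually.of_forall gaussMin_le_gaussAbs)
  filter_upwards [eventually_gt_atTop 0] with T hT
  linarith [gaussAbs_sub_gaussMin_le hT]

theorem Imod_nonneg {c : ℝ} (hc : 0 ≤ c) : 0 ≤ Imod c := by
  rw [Imod_eq hc]
  have := gaussMin_nonneg (T := √2 * c) (by positivity)
  positivity

theorem continuous_gaussMin : Continuous gaussMin :=
  LipschitzWith.continuous (K := 1) <| LipschitzWith.of_dist_le_mul fun S T => by
    simpa [Real.dist_eq] using abs_gaussMin_sub_le S T

theorem tendsto_Imod_zero : Tendsto Imod (𝓝[>] 0) (𝓝 0) := by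
  have h : Tendsto (fun c => √Real.pi * (√2 * gaussMin (√2 * c))) (𝓝[>] 0) (𝓝 0) := by
    have hc : Continuous fun c => √Real.pi * (√2 * gaussMin (√2 * c)) := by
      have := continuous_gaussMin
      fun_prop
    have := (hc.tendsto 0).mono_left (nhdsWithin_le_nhds (s := Set.Ioi 0))
    simpa [gaussMin_zero] using this
  refine h.congr' ?_
  filter_upwards [self_mem_nhdsWithin] with c hc
  exact (Imod_eq (le_of_lt hc)).symm

theorem tendsto_Imod_atTop : Tendsto Imod atTop (𝓝 2) := by
  have h1 : Tendsto (fun c : ℝ => √2 * c) atTop atTop :=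
    tendsto_id.const_mul_atTop (by positivity)
  have h2 := ((tendsto_gaussMin_atTop.comp h1).const_mul √2).const_mul √Real.pi
  have h3 : √Real.pi * (√2 * gaussAbs) = 2 := by
    rw [gaussAbs_eq]
    have h3 : √Real.pi ≠ 0 := by positivity
    have h4 : √(2 : ℝ) ^ 2 = 2 := Real.sq_sqrt (by norm_num)
    field_simp
    linarith
  rw [h3] at h2
  refine h2.congr' ?_
  filter_upwards [eventually_ge_atTop 0] with c hc
  exact (Imod_eq hc).symm

/-! ### Comparison of the variance with its Gaussian main term. -/

/-- The Gaussian approximation of the variance of the annulus count. -/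
noncomputable def varMain (N : ℕ) (a b : ℝ) : ℝ :=
  √(N : ℝ) * (gaussAbs * ((a + b) / √2 - √(a ^ 2 + b ^ 2)) +
    √(a ^ 2 + b ^ 2) * gaussMin (√(N : ℝ) * (b ^ 2 - a ^ 2) / √(a ^ 2 + b ^ 2)))

theorem abs_poissonAbsDiff_self_sub_le {x : NNReal} (hx : 0 < x) :
    absFourierConst * |poissonAbsDiff x x - √2 * √(x : ℝ) * gaussAbs| ≤ 8 + 4 * Real.pi := by
  have h := abs_poissonAbsDiff_sub_gaussian_le (x := x) (y := x) (by positivity)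
  rw [sub_self, integral_abs_gaussianReal le_rfl (by positivity), zero_div, gaussMin_zero,
    NNReal.coe_add, ← two_mul, Real.sqrt_mul (by norm_num)] at h
  simpa using h

/-- The bound depends only on `β`, not on `a`, `b` or `N`; this uniformity is what allows moving
endpoints. -/
theorem abs_modulusVar_sub_varMain_le {N : ℕ} (hN : 0 < N) {a b β : ℝ} (ha : 0 < a) (hab : a ≤ b)
    (hb : b ≤ β) (hβ : β < 1) :
    |modulusVar N a b - varMain N a b| ≤
      2 * ((8 + 4 * Real.pi) / absFourierConst) + 1 / (1 - β ^ 2) := by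
  have hN' : (0 : ℝ) < N := by exact_mod_cast hN
  have hb0 : 0 < b := ha.trans_le hab
  have hβ0 : 0 < 1 - β ^ 2 := by nlinarith
  have hb2 : b ^ 2 ≤ β ^ 2 := by gcongr
  have ha2 : a ^ 2 ≤ b ^ 2 := by gcongr
  obtain ⟨x, hx⟩ : ∃ x : NNReal, (x : ℝ) = N * a ^ 2 := ⟨⟨N * a ^ 2, by positivity⟩, rfl⟩
  obtain ⟨y, hy⟩ : ∃ y : NNReal, (y : ℝ) = N * b ^ 2 := ⟨⟨N * b ^ 2, by positivity⟩, rfl⟩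
  have hx0 : 0 < x := by
    have : (0 : ℝ) < x := by rw [hx]; positivity
    exact_mod_cast this
  have hy0 : 0 < y := by
    have : (0 : ℝ) < y := by rw [hy]; positivity
    exact_mod_cast this
  have htail : ∀ u : ℝ, u ^ 2 ≤ β ^ 2 → (N * u ^ 2 < N) ∧
      N * u ^ 2 / (4 * (N - N * u ^ 2)) ≤ 1 / (4 * (1 - β ^ 2)) := fun u hu => by
    have hu1 : 0 < 1 - u ^ 2 := by linarith
    refine ⟨by nlinarith, ?_⟩
    have e : N * u ^ 2 / (4 * (N - N * u ^ 2)) = u ^ 2 / (4 * (1 - u ^ 2)) := by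
      rw [show 4 * ((N : ℝ) - N * u ^ 2) = N * (4 * (1 - u ^ 2)) by ring,
        mul_div_mul_left _ _ hN'.ne']
    rw [e]
    gcongr
    linarith
  obtain ⟨hxN, hxt⟩ := htail a (ha2.trans hb2)
  obtain ⟨hyN, hyt⟩ := htail b hb2
  rw [← hx] at hxN hxt
  rw [← hy] at hyN hyt
  have hdisc := abs_sum_poissonCdf_sub_le x y hxN hyN
  have hvar : modulusVar N a b = ∑ k ∈ Finset.range N, (poissonCdf k x - poissonCdf k y) *
      (1 - (poissonCdf k x - poissonCdf k y)) := by
    rw [modulusVar_eq_sum hN ha.le hab, hx, hy]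
    rfl
  rw [← hvar] at hdisc
  have hxx := abs_poissonAbsDiff_self_sub_le hx0
  have hyy := abs_poissonAbsDiff_self_sub_le hy0
  have hyx := abs_poissonAbsDiff_sub_gaussian_le (x := y) (y := x) (by positivity)
  have hmn : (0 : ℝ) ≤ y - x := by rw [hx, hy]; nlinarith
  rw [integral_abs_gaussianReal hmn (by positivity)] at hyx
  have hdiv : ∀ u : ℝ, absFourierConst * |u| ≤ 8 + 4 * Real.pi →
      |u| ≤ (8 + 4 * Real.pi) / absFourierConst := fun u hu => by
    rw [le_div_iff₀ absFourierConst_pos, mul_comm]; exact hu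
  have hxx' := abs_le.mp (hdiv _ hxx)
  have hyy' := abs_le.mp (hdiv _ hyy)
  have hyx' := abs_le.mp (hdiv _ hyx)
  have hdisc' := abs_le.mp hdisc
  have hsx : √(x : ℝ) = √(N : ℝ) * a := by
    rw [hx, Real.sqrt_mul hN'.le, Real.sqrt_sq ha.le]
  have hsy : √(y : ℝ) = √(N : ℝ) * b := by
    rw [hy, Real.sqrt_mul hN'.le, Real.sqrt_sq hb0.le]
  have hsxy : √((y + x : NNReal) : ℝ) = √(N : ℝ) * √(a ^ 2 + b ^ 2) := by
    rw [NNReal.coe_add, hx, hy, ← Real.sqrt_mul hN'.le]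
    ring_nf
  have hr : 0 < √(a ^ 2 + b ^ 2) := by positivity
  have hsN : 0 < √(N : ℝ) := by positivity
  have harg : ((y : ℝ) - x) / (√(N : ℝ) * √(a ^ 2 + b ^ 2)) =
      √(N : ℝ) * (b ^ 2 - a ^ 2) / √(a ^ 2 + b ^ 2) := by
    rw [hx, hy]
    nth_rewrite 1 2 [← Real.mul_self_sqrt hN'.le]
    field_simp
  rw [hsxy, harg] at hyx'
  rw [hsx] at hxx'
  rw [hsy] at hyy'
  have h2 : (1 : ℝ) / √2 = √2 / 2 := by
    have := Real.mul_self_sqrt (show (0 : ℝ) ≤ 2 by norm_num)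
    field_simp
    linarith
  -- The mean `y - x` of the Gaussian cancels against the linear term of the exact formula.
  have hmain : varMain N a b = √2 * (√(N : ℝ) * a) * gaussAbs / 2 +
      √2 * (√(N : ℝ) * b) * gaussAbs / 2 -
      (√(N : ℝ) * √(a ^ 2 + b ^ 2) * gaussAbs + (y - x) - √(N : ℝ) * √(a ^ 2 + b ^ 2) *
        gaussMin (√(N : ℝ) * (b ^ 2 - a ^ 2) / √(a ^ 2 + b ^ 2))) + (y - x) := by
    rw [varMain, div_eq_mul_one_div (a + b), h2]
    ring
  -- The tails come with weights 3 and 1, hence four times the common bound; the Gaussian errors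
  -- come with weights 1/2, 1/2 and 1, hence the factor 2.
  have h4 : 1 / (1 - β ^ 2) = 4 * (1 / (4 * (1 - β ^ 2))) := by
    field_simp
  rw [hmain, h4, abs_le]
  constructor <;> linarith [hxx'.1, hxx'.2, hyy'.1, hyy'.2, hyx'.1, hyx'.2, hdisc'.1, hdisc'.2]

theorem sqrt_mul_Imod {c : ℝ} (hc : 0 ≤ c) (N : ℕ) (a : ℝ) :
    √(N : ℝ) * (a / √Real.pi) * Imod c = √(N : ℝ) * (√2 * a * gaussMin (√2 * c)) := by
  rw [Imod_eq hc]
  have : √Real.pi ≠ 0 := by positivity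
  field_simp

theorem sqrt_sq_add_sq_bounds {a b : ℝ} (ha : 0 < a) (hab : a ≤ b) :
    (a + b) / √2 ≤ √(a ^ 2 + b ^ 2) ∧ √(a ^ 2 + b ^ 2) ≤ (a + b) / √2 + (b - a) / √2 ∧
      √2 * a ≤ √(a ^ 2 + b ^ 2) ∧ √(a ^ 2 + b ^ 2) ≤ √2 * b := by
  have h2 : √(2 : ℝ) ^ 2 = 2 := Real.sq_sqrt (by norm_num)
  have hb : 0 < b := ha.trans_le hab
  have h3 : (a + b) / √2 + (b - a) / √2 = √2 * b := by
    field_simp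
    rw [h2]
    ring
  have h4 : √(a ^ 2 + b ^ 2) ≤ √2 * b := by
    apply Real.sqrt_le_iff.mpr ⟨by positivity, ?_⟩
    rw [mul_pow, h2]
    nlinarith
  refine ⟨?_, h3 ▸ h4, ?_, h4⟩
  · apply Real.le_sqrt_of_sq_le
    rw [div_pow, h2]
    nlinarith [sq_nonneg (a - b)]
  · apply Real.le_sqrt_of_sq_le
    rw [mul_pow, h2]
    nlinarith

/-- Replacing `√(a² + b²)` by `√2 a` or by `(a + b) / √2` costs `O(b - a)`, and the Lipschitz bound
controls the change in the argument of `gaussMin`. After multiplication by `√N` the error is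
polynomial in `s = √N (b - a)`, hence bounded when `s` is. -/
theorem abs_varMain_sub_Imod_le {N : ℕ} {a b : ℝ} (ha : 0 < a) (hab : a ≤ b) :
    |varMain N a b - √(N : ℝ) * (a / √Real.pi) * Imod (√(N : ℝ) * (b - a))| ≤
      4 * gaussAbs * (√(N : ℝ) * (b - a)) + 2 * (√(N : ℝ) * (b - a)) ^ 2 := by
  have hq : 0 ≤ √(N : ℝ) := Real.sqrt_nonneg _
  set q := √(N : ℝ) with hqdef
  have hd : 0 ≤ b - a := sub_nonneg.mpr hab
  have hs : 0 ≤ q * (b - a) := mul_nonneg hq hd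
  rw [hqdef, sqrt_mul_Imod hs, varMain, ← hqdef]
  set s := q * (b - a) with hsdef
  obtain ⟨h1, h2, h3, h4⟩ := sqrt_sq_add_sq_bounds ha hab
  have h22 : √(2 : ℝ) ^ 2 = 2 := Real.sq_sqrt (by norm_num)
  have h20 : 0 < √(2 : ℝ) := by positivity
  have h21 : 1 ≤ √(2 : ℝ) := Real.one_le_sqrt.mpr (by norm_num)
  have h2h : √(2 : ℝ) ≤ 2 := by nlinarith
  set r := √(a ^ 2 + b ^ 2) with hr
  have hr0 : 0 < r := lt_of_lt_of_le (by positivity) h3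
  have hk := gaussAbs_pos
  set T := q * (b ^ 2 - a ^ 2) / r with hT
  have hT0 : 0 ≤ T := by
    have : b ^ 2 - a ^ 2 = (b - a) * (b + a) := by ring
    rw [hT, this]
    have : 0 < b + a := by linarith
    positivity
  have hdiv : (b - a) / √2 ≤ b - a := div_le_self hd h21
  have hJ := abs_le.mp (abs_gaussMin_sub_le T (√2 * s))
  have hTs : |T - √2 * s| * (√2 * a) ≤ 2 * s * (b - a) := by
    have e : T - √2 * s = s * √2 * ((a + b) / √2 - r) / r := by
      rw [hT, hsdef]
      field_simp
      ring
    have h5 : |(a + b) / √2 - r| ≤ b - a := abs_le.mpr ⟨by linarith, by linarith⟩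
    rw [e, abs_div, abs_of_pos hr0, abs_mul, abs_of_nonneg (by positivity : 0 ≤ s * √2),
      div_mul_eq_mul_div, div_le_iff₀ hr0]
    calc s * √2 * |(a + b) / √2 - r| * (√2 * a) ≤ s * 2 * (b - a) * r := by gcongr
      _ = _ := by ring
  have hE : |r * gaussMin T - √2 * a * gaussMin (√2 * s)| ≤
      2 * (b - a) * gaussAbs + 2 * s * (b - a) := by
    have e : r * gaussMin T - √2 * a * gaussMin (√2 * s) =
        (r - √2 * a) * gaussMin T + (gaussMin T - gaussMin (√2 * s)) * (√2 * a) := by ring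
    rw [e]
    refine (abs_add_le _ _).trans (add_le_add ?_ ?_)
    · rw [abs_mul, abs_of_nonneg (gaussMin_nonneg hT0), abs_of_nonneg (by linarith)]
      have : r - √2 * a ≤ 2 * (b - a) := by nlinarith
      exact mul_le_mul this (gaussMin_le_gaussAbs T) (gaussMin_nonneg hT0) (by linarith)
    · rw [abs_mul, abs_of_pos (by positivity : 0 < √2 * a)]
      exact (mul_le_mul_of_nonneg_right (abs_gaussMin_sub_le _ _) (by positivity)).trans hTs
  have hF : |gaussAbs * ((a + b) / √2 - r)| ≤ gaussAbs * (b - a) := by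
    rw [abs_mul, abs_of_pos hk]
    gcongr
    exact abs_le.mpr ⟨by linarith, by linarith⟩
  have e : q * (gaussAbs * ((a + b) / √2 - r) + r * gaussMin T) -
      q * (√2 * a * gaussMin (√2 * s)) = q * (gaussAbs * ((a + b) / √2 - r) +
        (r * gaussMin T - √2 * a * gaussMin (√2 * s))) := by ring
  rw [e, abs_mul, abs_of_nonneg hq]
  calc q * |gaussAbs * ((a + b) / √2 - r) + (r * gaussMin T - √2 * a * gaussMin (√2 * s))|
      ≤ q * (gaussAbs * (b - a) + (2 * (b - a) * gaussAbs + 2 * s * (b - a))) := by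
        gcongr
        exact (abs_add_le _ _).trans (add_le_add hF hE)
    _ = 3 * gaussAbs * s + 2 * s ^ 2 := by rw [hsdef]; ring
    _ ≤ _ := by nlinarith [mul_nonneg hk.le hs]

theorem exists_abs_modulusVar_sub_varMain_le {β : ℝ} (hβ : β < 1) :
    ∃ C : ℝ, 0 ≤ C ∧ ∀ {N : ℕ} {a b : ℝ}, 0 < N → 0 < a → a ≤ b → b ≤ β →
      |modulusVar N a b - varMain N a b| ≤ C :=
  ⟨max (2 * ((8 + 4 * Real.pi) / absFourierConst) + 1 / (1 - β ^ 2)) 0, le_max_right _ _,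
    fun hN ha hab hb => (abs_modulusVar_sub_varMain_le hN ha hab hb hβ).trans (le_max_left _ _)⟩

theorem gaussAbs_div_sqrt_two : gaussAbs / √2 = 1 / √Real.pi := by
  rw [gaussAbs_eq]
  field_simp

/-- By monotonicity it suffices to treat `T ≤ 1/2`, where `T - T² > 0`. -/
theorem gaussMin_pos {T : ℝ} (hT : 0 < T) : 0 < gaussMin T := by
  have h0 : 0 < min T (1 / 2) := lt_min hT (by norm_num)
  have h1 : gaussMin (min T (1 / 2)) ≤ gaussMin T :=
    integral_mono (integrable_min_abs_std _) (integrable_min_abs_std _) fun z =>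
      min_le_min_right _ (min_le_left _ _)
  have h2 := sub_gaussMin_le h0.le
  have h3 : min T (1 / 2) ≤ 1 / 2 := min_le_right _ _
  nlinarith

theorem isEquivalent_of_abs_sub_le {u v e : ℕ → ℝ} (he : Tendsto e atTop (𝓝 0))
    (h : ∀ᶠ n in atTop, |u n - v n| ≤ e n * |v n|) : u ~[atTop] v := by
  rw [IsEquivalent, isLittleO_iff]
  intro c hc
  filter_upwards [h, he.eventually_le_const hc] with n h1 h2
  exact h1.trans (mul_le_mul_of_nonneg_right h2 (abs_nonneg _))

theorem isEquivalent_of_tendsto_div {u v s : ℕ → ℝ} {l : ℝ} (hl : l ≠ 0)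
    (hs : ∀ᶠ n in atTop, s n ≠ 0) (hu : Tendsto (fun n => u n / s n) atTop (𝓝 l))
    (hv : Tendsto (fun n => v n / s n) atTop (𝓝 l)) : u ~[atTop] v := by
  refine isEquivalent_of_tendsto_one ?_
  have h := hu.div hv hl
  rw [div_self hl] at h
  refine h.congr' ?_
  filter_upwards [hs] with n hn
  simp only [Pi.div_apply]
  exact div_div_div_cancel_right₀ hn _ _

/-! ### Intervals with fixed endpoints. -/

theorem modulusVar_fixed {a b : ℝ} (ha : 0 < a) (hab : a < b) (hb : b < 1) :
    (fun N : ℕ => modulusVar N a b - √(N : ℝ) * ((a + b) / √Real.pi))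
      =O[atTop] fun _ : ℕ => (1 : ℝ) := by
  obtain ⟨C, -, hC⟩ := exists_abs_modulusVar_sub_varMain_le hb
  refine IsBigO.of_bound (C + (a ^ 2 + b ^ 2) / (4 * (b ^ 2 - a ^ 2))) ?_
  filter_upwards [eventually_gt_atTop 0] with N hN
  have h1 := hC hN ha hab.le le_rfl
  have hN' : (0 : ℝ) < N := by exact_mod_cast hN
  have hq : 0 < √(N : ℝ) := by positivity
  have hr : 0 < √(a ^ 2 + b ^ 2) := by positivity
  have hr2 : √(a ^ 2 + b ^ 2) ^ 2 = a ^ 2 + b ^ 2 := Real.sq_sqrt (by positivity)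
  have hd : 0 < b ^ 2 - a ^ 2 := by nlinarith
  have hT : 0 < √(N : ℝ) * (b ^ 2 - a ^ 2) / √(a ^ 2 + b ^ 2) := by positivity
  -- The two `√(a² + b²)` terms combine into the defect `gaussAbs - gaussMin T`. Here `T` is of
  -- order `√N`, so the `1 / (4T)` bound offsets the prefactor `√N`.
  have h2 : varMain N a b - √(N : ℝ) * ((a + b) / √Real.pi) =
      -(√(N : ℝ) * √(a ^ 2 + b ^ 2) *
        (gaussAbs - gaussMin (√(N : ℝ) * (b ^ 2 - a ^ 2) / √(a ^ 2 + b ^ 2)))) := by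
    have : (a + b) / √Real.pi = (a + b) * (gaussAbs / √2) := by
      rw [gaussAbs_div_sqrt_two]; ring
    rw [varMain, this]
    ring
  have h3 : |varMain N a b - √(N : ℝ) * ((a + b) / √Real.pi)| ≤
      (a ^ 2 + b ^ 2) / (4 * (b ^ 2 - a ^ 2)) := by
    have h4 := gaussAbs_sub_gaussMin_le hT
    have h5 := sub_nonneg.mpr (gaussMin_le_gaussAbs
      (√(N : ℝ) * (b ^ 2 - a ^ 2) / √(a ^ 2 + b ^ 2)))
    rw [h2, abs_neg, abs_of_nonneg (by positivity)]
    calc _ ≤ √(N : ℝ) * √(a ^ 2 + b ^ 2) *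
          (1 / (4 * (√(N : ℝ) * (b ^ 2 - a ^ 2) / √(a ^ 2 + b ^ 2)))) := by gcongr
      _ = _ := by
        field_simp
        rw [hr2]
  rw [norm_one, mul_one, Real.norm_eq_abs]
  calc _ = |(modulusVar N a b - varMain N a b) +
        (varMain N a b - √(N : ℝ) * ((a + b) / √Real.pi))| := by ring_nf
    _ ≤ _ := (abs_add_le _ _).trans (add_le_add h1 h3)

/-! ### Shrinking intervals: wide, critical and narrow regimes. -/

section Shrinking

variable {a b : ℕ → ℝ} {α : ℝ}

/-- Any `β` strictly between `α` and 1 eventually dominates `b N`, and `N (b N - a N) → ∞` forces `a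
N < b N`. -/
theorem exists_shrinking_bound (h0 : 0 < α) (h1 : α < 1) (ha : Tendsto a atTop (𝓝 α))
    (hd : Tendsto (fun N => b N - a N) atTop (𝓝 0))
    (hN : Tendsto (fun N : ℕ => (N : ℝ) * (b N - a N)) atTop atTop) :
    ∃ C : ℝ, 0 ≤ C ∧ ∀ᶠ N : ℕ in atTop, 0 < N ∧ 0 < a N ∧ a N < b N ∧ b N < 1 ∧
      |modulusVar N (a N) (b N) - varMain N (a N) (b N)| ≤ C := by
  obtain ⟨β, hαβ, hβ⟩ := exists_between h1
  obtain ⟨C, hC0, hC⟩ := exists_abs_modulusVar_sub_varMain_le hβ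
  have hb : Tendsto b atTop (𝓝 α) := by
    simpa using ha.add hd
  refine ⟨C, hC0, ?_⟩
  filter_upwards [eventually_gt_atTop 0, ha.eventually_const_lt h0, hN.eventually_gt_atTop 0,
    hb.eventually_lt_const hαβ] with N hN0 haN hdN hbN
  have hab : a N < b N := by
    have : (0 : ℝ) < N := by exact_mod_cast hN0
    exact sub_pos.mp (pos_of_mul_pos_right hdN this.le)
  exact ⟨hN0, haN, hab, hbN.trans hβ, hC hN0 haN hab.le hbN.le⟩

theorem tendsto_sqrt_natCast_atTop : Tendsto (fun N : ℕ => √(N : ℝ)) atTop atTop :=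
  Real.tendsto_sqrt_atTop.comp tendsto_natCast_atTop_atTop

theorem tendsto_div_sqrt_of_abs_sub_le {u w : ℕ → ℝ} {C l : ℝ}
    (h : ∀ᶠ N : ℕ in atTop, |u N - √(N : ℝ) * w N| ≤ C) (hw : Tendsto w atTop (𝓝 l)) :
    Tendsto (fun N : ℕ => u N / √(N : ℝ)) atTop (𝓝 l) := by
  have h1 : Tendsto (fun N : ℕ => C / √(N : ℝ)) atTop (𝓝 0) :=
    tendsto_const_nhds.div_atTop tendsto_sqrt_natCast_atTop
  have h2 : Tendsto (fun N : ℕ => u N / √(N : ℝ) - w N) atTop (𝓝 0) := by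
    refine squeeze_zero_norm' ?_ h1
    filter_upwards [h, tendsto_sqrt_natCast_atTop.eventually_gt_atTop 0] with N hN hq
    rw [Real.norm_eq_abs, div_sub' hq.ne', abs_div, abs_of_pos hq]
    gcongr
  simpa using h2.add hw

theorem modulusVar_wide (h0 : 0 < α) (h1 : α < 1) (ha : Tendsto a atTop (𝓝 α))
    (hd : Tendsto (fun N => b N - a N) atTop (𝓝 0))
    (hN : Tendsto (fun N : ℕ => (N : ℝ) * (b N - a N)) atTop atTop)
    (hs : Tendsto (fun N : ℕ => √(N : ℝ) * (b N - a N)) atTop atTop) :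
    (fun N : ℕ => modulusVar N (a N) (b N))
      ~[atTop] fun N : ℕ => √(N : ℝ) * (2 * a N / √Real.pi) := by
  obtain ⟨C, -, hC⟩ := exists_shrinking_bound h0 h1 ha hd hN
  have hb : Tendsto b atTop (𝓝 α) := by
    simpa using ha.add hd
  have hr : Tendsto (fun N => √(a N ^ 2 + b N ^ 2)) atTop (𝓝 (√2 * α)) := by
    have h := ((ha.pow 2).add (hb.pow 2)).sqrt
    rwa [← two_mul, Real.sqrt_mul (by norm_num), Real.sqrt_sq h0.le] at h
  have hr0 : 0 < √2 * α := by positivity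
  -- Factor `b² - a² = (b - a)(a + b)`: the diverging `√N (b - a)` is multiplied by a quantity with
  -- positive limit.
  have hT : Tendsto (fun N : ℕ => √(N : ℝ) * (b N ^ 2 - a N ^ 2) / √(a N ^ 2 + b N ^ 2))
      atTop atTop := by
    have h := hs.atTop_mul_pos (by positivity : 0 < (α + α) / (√2 * α)) ((ha.add hb).div hr hr0.ne')
    refine h.congr fun N => ?_
    simp only [Pi.div_apply]
    ring
  have hw := (((ha.add hb).div_const √2).sub hr).const_mul gaussAbs |>.add
    (hr.mul (tendsto_gaussMin_atTop.comp hT))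
  have hl : gaussAbs * ((α + α) / √2 - √2 * α) + √2 * α * gaussAbs = 2 * α / √Real.pi := by
    have : 2 * α / √Real.pi = 2 * α * (gaussAbs / √2) := by
      rw [gaussAbs_div_sqrt_two]; ring
    rw [this]
    ring
  rw [hl] at hw
  refine isEquivalent_of_tendsto_div (s := fun N : ℕ => √(N : ℝ)) (l := 2 * α / √Real.pi)
    (by positivity) ?_ (tendsto_div_sqrt_of_abs_sub_le (C := C) ?_ hw) ?_
  · filter_upwards [tendsto_sqrt_natCast_atTop.eventually_gt_atTop 0] with N hq using hq.ne'
  · filter_upwards [hC] with N h using h.2.2.2.2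
  · refine ((ha.const_mul 2).div_const √Real.pi).congr' ?_
    filter_upwards [tendsto_sqrt_natCast_atTop.eventually_gt_atTop 0] with N hq
    rw [mul_div_cancel_left₀ _ hq.ne']

theorem exists_abs_modulusVar_sub_Imod_le (h0 : 0 < α) (h1 : α < 1) (ha : Tendsto a atTop (𝓝 α))
    (hd : Tendsto (fun N => b N - a N) atTop (𝓝 0))
    (hN : Tendsto (fun N : ℕ => (N : ℝ) * (b N - a N)) atTop atTop) {c : ℝ}
    (hs : Tendsto (fun N : ℕ => √(N : ℝ) * (b N - a N)) atTop (𝓝 c)) :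
    ∃ C : ℝ, 0 ≤ C ∧ ∀ᶠ N : ℕ in atTop, 0 < N ∧ 0 < a N ∧ a N < b N ∧ b N < 1 ∧
      |modulusVar N (a N) (b N)
        - √(N : ℝ) * (a N / √Real.pi) * Imod (√(N : ℝ) * (b N - a N))| ≤ C := by
  obtain ⟨C, hC0, hC⟩ := exists_shrinking_bound h0 h1 ha hd hN
  have hk := gaussAbs_pos
  have hc : 0 ≤ c := ge_of_tendsto hs (by
    filter_upwards [hC] with N h
    exact mul_nonneg (Real.sqrt_nonneg _) (by linarith [h.2.2.1]))
  refine ⟨C + (4 * gaussAbs * (c + 1) + 2 * (c + 1) ^ 2), by positivity, ?_⟩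
  filter_upwards [hC, hs.eventually_le_const (lt_add_one c)] with N h hsN
  obtain ⟨hN0, haN, hab, hbN, hV⟩ := h
  refine ⟨hN0, haN, hab, hbN, ?_⟩
  have hs0 : 0 ≤ √(N : ℝ) * (b N - a N) := mul_nonneg (Real.sqrt_nonneg _) (by linarith)
  have h2 := abs_varMain_sub_Imod_le (N := N) haN hab.le
  calc _ = |(modulusVar N (a N) (b N) - varMain N (a N) (b N)) + (varMain N (a N) (b N) -
        √(N : ℝ) * (a N / √Real.pi) * Imod (√(N : ℝ) * (b N - a N)))| := by ring_nf
    _ ≤ _ := (abs_add_le _ _).trans (add_le_add hV h2)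
    _ ≤ _ := by gcongr

theorem modulusVar_critical_window (h0 : 0 < α) (h1 : α < 1) (ha : Tendsto a atTop (𝓝 α))
    (hd : Tendsto (fun N => b N - a N) atTop (𝓝 0))
    (hN : Tendsto (fun N : ℕ => (N : ℝ) * (b N - a N)) atTop atTop) {c : ℝ}
    (hs : Tendsto (fun N : ℕ => √(N : ℝ) * (b N - a N)) atTop (𝓝 c)) :
    (fun N : ℕ => modulusVar N (a N) (b N)
        - √(N : ℝ) * (a N / √Real.pi) * Imod (√(N : ℝ) * (b N - a N)))
      =O[atTop] fun _ : ℕ => (1 : ℝ) := by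
  obtain ⟨C, -, hC⟩ := exists_abs_modulusVar_sub_Imod_le h0 h1 ha hd hN hs
  refine IsBigO.of_bound C ?_
  filter_upwards [hC] with N h
  rw [norm_one, mul_one]
  exact h.2.2.2.2

theorem modulusVar_critical_isEquivalent (h0 : 0 < α) (h1 : α < 1) (ha : Tendsto a atTop (𝓝 α))
    (hd : Tendsto (fun N => b N - a N) atTop (𝓝 0))
    (hN : Tendsto (fun N : ℕ => (N : ℝ) * (b N - a N)) atTop atTop) {c : ℝ} (hc : 0 < c)
    (hs : Tendsto (fun N : ℕ => √(N : ℝ) * (b N - a N)) atTop (𝓝 c)) :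
    (fun N : ℕ => modulusVar N (a N) (b N))
      ~[atTop] fun N : ℕ => √(N : ℝ) * (a N / √Real.pi) * Imod c := by
  obtain ⟨C, -, hC⟩ := exists_abs_modulusVar_sub_Imod_le h0 h1 ha hd hN hs
  have hI : Tendsto (fun N : ℕ => Imod (√(N : ℝ) * (b N - a N))) atTop (𝓝 (Imod c)) := by
    rw [Imod_eq hc.le]
    have h := (((continuous_gaussMin.tendsto _).comp (hs.const_mul √2)).const_mul √2).const_mul
      √Real.pi
    refine h.congr' ?_
    filter_upwards [hs.eventually_const_lt hc] with N hsN
    rw [Imod_eq hsN.le]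
    rfl
  have hIc : 0 < Imod c := by
    rw [Imod_eq hc.le]
    have := gaussMin_pos (T := √2 * c) (by positivity)
    positivity
  refine isEquivalent_of_tendsto_div (s := fun N : ℕ => √(N : ℝ)) (l := α / √Real.pi * Imod c)
    (by positivity) ?_
    (tendsto_div_sqrt_of_abs_sub_le (C := C) ?_ ((ha.div_const √Real.pi).mul hI)) ?_
  · filter_upwards [tendsto_sqrt_natCast_atTop.eventually_gt_atTop 0] with N hq using hq.ne'
  · filter_upwards [hC] with N h
    rw [← mul_assoc]
    exact h.2.2.2.2
  · refine ((ha.div_const √Real.pi).mul_const (Imod c)).congr' ?_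
    filter_upwards [tendsto_sqrt_natCast_atTop.eventually_gt_atTop 0] with N hq
    rw [mul_assoc, mul_div_cancel_left₀ _ hq.ne']

theorem modulusVar_critical_rate (h0 : 0 < α) (h1 : α < 1) (ha : Tendsto a atTop (𝓝 α))
    (hd : Tendsto (fun N => b N - a N) atTop (𝓝 0))
    (hN : Tendsto (fun N : ℕ => (N : ℝ) * (b N - a N)) atTop atTop) {c : ℝ} (hc : 0 < c)
    (hs : Tendsto (fun N : ℕ => √(N : ℝ) * (b N - a N)) atTop (𝓝 c))
    (hrate : (fun N : ℕ => √(N : ℝ) * (b N - a N) - c) =O[atTop] fun N : ℕ => 1 / √(N : ℝ)) :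
    (fun N : ℕ => modulusVar N (a N) (b N) - √(N : ℝ) * (a N / √Real.pi) * Imod c)
      =O[atTop] fun _ : ℕ => (1 : ℝ) := by
  obtain ⟨C, hC0, hC⟩ := exists_abs_modulusVar_sub_Imod_le h0 h1 ha hd hN hs
  obtain ⟨K, hK0, hK⟩ := hrate.exists_pos
  rw [IsBigOWith] at hK
  refine IsBigO.of_bound (C + 2 * K) ?_
  filter_upwards [hC, hK, hs.eventually_const_lt hc] with N h hKN hs0
  obtain ⟨hN0, haN, hab, hbN, hV⟩ := h
  have hq : 0 < √(N : ℝ) := Real.sqrt_pos.mpr (by exact_mod_cast hN0)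
  have h22 : √(2 : ℝ) * √2 = 2 := Real.mul_self_sqrt (by norm_num)
  rw [Real.norm_eq_abs, Real.norm_of_nonneg (by positivity), mul_one_div, le_div_iff₀ hq] at hKN
  have h2 : |√(N : ℝ) * (a N / √Real.pi) * Imod (√(N : ℝ) * (b N - a N)) -
      √(N : ℝ) * (a N / √Real.pi) * Imod c| ≤ 2 * K := by
    rw [sqrt_mul_Imod hs0.le, sqrt_mul_Imod hc.le, ← mul_sub, ← mul_sub, abs_mul, abs_mul,
      abs_of_pos hq, abs_of_pos (by positivity : 0 < √2 * a N)]
    -- The Lipschitz bound turns the `O(N^{-1/2})` rate into an `O(1)` error after multiplication by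
    -- `√N`.
    have h3 := abs_gaussMin_sub_le (√2 * (√(N : ℝ) * (b N - a N))) (√2 * c)
    rw [← mul_sub, abs_mul, abs_of_nonneg (Real.sqrt_nonneg 2)] at h3
    calc _ ≤ √(N : ℝ) * (√2 * 1 * (√2 * |√(N : ℝ) * (b N - a N) - c|)) := by
          gcongr
          linarith
      _ = (√2 * √2) * (|√(N : ℝ) * (b N - a N) - c| * √(N : ℝ)) := by ring
      _ ≤ _ := by rw [h22]; gcongr
  rw [norm_one, mul_one, Real.norm_eq_abs]
  exact (abs_sub_le _ _ _).trans (add_le_add hV h2)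

/-- For small arguments `gaussMin T = T + O(T²)`, so the `Imod` term linearizes to `2 a N (b - a)`.
The remaining `O(1)` error is negligible precisely because `N (b - a) → ∞`. -/
theorem modulusVar_narrow (h0 : 0 < α) (h1 : α < 1) (ha : Tendsto a atTop (𝓝 α))
    (hd : Tendsto (fun N => b N - a N) atTop (𝓝 0))
    (hN : Tendsto (fun N : ℕ => (N : ℝ) * (b N - a N)) atTop atTop)
    (hs : Tendsto (fun N : ℕ => √(N : ℝ) * (b N - a N)) atTop (𝓝 0)) :
    (fun N : ℕ => modulusVar N (a N) (b N))
      ~[atTop] fun N : ℕ => (N : ℝ) * (b N ^ 2 - a N ^ 2) := by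
  obtain ⟨C, hC0, hC⟩ := exists_abs_modulusVar_sub_Imod_le h0 h1 ha hd hN hs
  have hb : Tendsto b atTop (𝓝 α) := by
    simpa using ha.add hd
  have hab : Tendsto (fun N => a N + b N) atTop (𝓝 (2 * α)) := by
    rw [two_mul]; exact ha.add hb
  -- The three relative errors come from the bounded Gaussian error, the quadratic remainder of
  -- `gaussMin`, and the replacement of `2a` by `a + b`.
  have he : Tendsto (fun N : ℕ => (C / ((N : ℝ) * (b N - a N)) +
      (2 * √2 * (√(N : ℝ) * (b N - a N)) + (b N - a N))) / (a N + b N)) atTop (𝓝 0) := by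
    have h := (((tendsto_const_nhds (x := C)).div_atTop hN).add
      ((hs.const_mul (2 * √2)).add hd)).div hab (by positivity)
    rw [mul_zero, add_zero, add_zero, zero_div] at h
    exact h
  refine isEquivalent_of_abs_sub_le he ?_
  filter_upwards [hC] with N h
  obtain ⟨hN0, haN, habN, hbN, hV⟩ := h
  have hN' : (0 : ℝ) < N := by exact_mod_cast hN0
  have hd0 : 0 < b N - a N := sub_pos.mpr habN
  have hq : 0 < √(N : ℝ) := Real.sqrt_pos.mpr hN'
  have hqq : √(N : ℝ) * √(N : ℝ) = N := Real.mul_self_sqrt hN'.le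
  have h22 : √(2 : ℝ) * √2 = 2 := Real.mul_self_sqrt (by norm_num)
  have hsum : 0 < a N + b N := by linarith
  set q := √(N : ℝ) with hqdef
  set d := b N - a N with hddef
  have hv : (N : ℝ) * (b N ^ 2 - a N ^ 2) = N * d * (a N + b N) := by rw [hddef]; ring
  have hw : 0 < (N : ℝ) * d := by positivity
  rw [hqdef, sqrt_mul_Imod (by positivity), ← hqdef] at hV
  have hJ1 := gaussMin_le (√2 * (q * d))
  have hJ2 := sub_gaussMin_le (T := √2 * (q * d)) (by positivity)
  have h3 : |q * (√2 * a N * gaussMin (√2 * (q * d))) - 2 * a N * (N * d)| ≤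
      N * d * (2 * √2 * (q * d)) := by
    have e : q * (√2 * a N * gaussMin (√2 * (q * d))) - 2 * a N * (N * d) =
        -(q * (√2 * a N) * (√2 * (q * d) - gaussMin (√2 * (q * d)))) := by
      linear_combination (a N * d * q * q) * h22 + 2 * a N * d * hqq
    rw [e, abs_neg, abs_of_nonneg (by
      have := sub_nonneg.mpr hJ1
      positivity)]
    calc _ ≤ q * (√2 * 1) * (√2 * (q * d)) ^ 2 := by
          gcongr
          linarith
      _ = (q * q) * d * ((√2 * √2) * √2 * (q * d)) := by ring
      _ = _ := by rw [hqq, h22]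
  have h4 : |2 * a N * (N * d) - N * d * (a N + b N)| ≤ N * d * d := by
    have e : 2 * a N * (N * d) - N * d * (a N + b N) = -(N * d * d) := by rw [hddef]; ring
    rw [e, abs_neg, abs_of_nonneg (by positivity)]
  rw [hv, abs_of_pos (by positivity : 0 < (N : ℝ) * d * (a N + b N))]
  calc |modulusVar N (a N) (b N) - N * d * (a N + b N)|
      ≤ C + (N * d * (2 * √2 * (q * d)) + N * d * d) :=
        (abs_sub_le _ _ _).trans (add_le_add hV ((abs_sub_le _ _ _).trans (add_le_add h3 h4)))
    _ = _ := by field_simp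

end Shrinking

theorem theorem6 :
    -- fixed intervals
    (∀ a b : ℝ, 0 < a → a < b → b < 1 →
      (fun N : ℕ => modulusVar N a b - √(N : ℝ) * ((a + b) / √Real.pi))
        =O[atTop] fun _ : ℕ => (1 : ℝ)) ∧
    -- intervals shrinking to an interior point
    (∀ (a b : ℕ → ℝ) (α : ℝ), 0 < α → α < 1 →
      Tendsto a atTop (𝓝 α) →
      Tendsto (fun N => b N - a N) atTop (𝓝 0) →
      Tendsto (fun N : ℕ => (N : ℝ) * (b N - a N)) atTop atTop →
      (Tendsto (fun N : ℕ => √(N : ℝ) * (b N - a N)) atTop atTop →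
        (fun N : ℕ => modulusVar N (a N) (b N))
          ~[atTop] fun N : ℕ => √(N : ℝ) * (2 * a N / √Real.pi)) ∧
      (∀ c : ℝ, 0 < c →
        Tendsto (fun N : ℕ => √(N : ℝ) * (b N - a N)) atTop (𝓝 c) →
        ((fun N : ℕ => modulusVar N (a N) (b N)
            - √(N : ℝ) * (a N / √Real.pi) * Imod (√(N : ℝ) * (b N - a N)))
          =O[atTop] fun _ : ℕ => (1 : ℝ)) ∧
        ((fun N : ℕ => modulusVar N (a N) (b N))
          ~[atTop] fun N : ℕ => √(N : ℝ) * (a N / √Real.pi) * Imod c) ∧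
        (((fun N : ℕ => √(N : ℝ) * (b N - a N) - c)
            =O[atTop] fun N : ℕ => 1 / √(N : ℝ)) →
          (fun N : ℕ => modulusVar N (a N) (b N)
              - √(N : ℝ) * (a N / √Real.pi) * Imod c)
            =O[atTop] fun _ : ℕ => (1 : ℝ))) ∧
      (Tendsto (fun N : ℕ => √(N : ℝ) * (b N - a N)) atTop (𝓝 0) →
        (fun N : ℕ => modulusVar N (a N) (b N))
          ~[atTop] fun N : ℕ => (N : ℝ) * (b N ^ 2 - a N ^ 2))) ∧
    -- the function `Imod`
    (∀ c : ℝ, 0 ≤ c →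
      Integrable (fun x : ℝ => gaussWindow c x - gaussWindow c x ^ 2) ∧ 0 ≤ Imod c) ∧
    Tendsto Imod (𝓝[>] 0) (𝓝 0) ∧
    Tendsto Imod atTop (𝓝 2) :=
  ⟨fun _ _ ha hab hb => modulusVar_fixed ha hab hb,
    fun _ _ _ h0 h1 ha hd hN =>
      ⟨fun hs => modulusVar_wide h0 h1 ha hd hN hs,
        fun _ hc hs => ⟨modulusVar_critical_window h0 h1 ha hd hN hs,
          modulusVar_critical_isEquivalent h0 h1 ha hd hN hc hs,
          fun hrate => modulusVar_critical_rate h0 h1 ha hd hN hc hs hrate⟩,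
        fun hs => modulusVar_narrow h0 h1 ha hd hN hs⟩,
    fun _ hc => ⟨integrable_gaussWindow_sub_sq hc, Imod_nonneg hc⟩,
    tendsto_Imod_zero, tendsto_Imod_atTop⟩
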